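/- Let $E\to M$ be a smooth real vector bundle over a smooth manifold and let $n\ge 1$ be an integer. Let $\mathfrak D E$ be the gauge algebroid of $E$: its sections are the derivations $\mathfrak d:\Gamma(E)\to\Gamma(E)$, i.e. the $\mathbb R$-linear maps with $\mathfrak d(fu)=\mathbb j(\mathfrak d)(f)\,u+f\,\mathfrak d u$ for a vector field $\mathbb j(\mathfrak d)$ on $M$, with bracket the commutator and anchor $\mathbb j:\mathfrak D E\to TM$; the kernel of $\mathbb j$ is $\mathfrak{gl}(E)=\mathrm{End}(E)$. Let $\mathbb d$ be the de Rham differential of $\mathfrak D E$ with coefficients in $E$, acting on $\Omega^k(\mathfrak D E,E)=\Gamma(\mathrm{Hom}(\wedge^k\mathfrak D E,E))$, and let $\mathfrak L$ be the corresponding Lie derivative. For $k\ge1$ let $\mathfrak J_kE\subset\mathrm{Hom}(\wedge^k\mathfrak D E,E)$ consist of those $\mu$ for which there is $\lambda\in\mathrm{Hom}(\wedge^{k-1}TM,E)$ with $\iota_\Phi\mu=\Phi\circ\mathbb j^*\lambda$ for all $\Phi\in\mathfrak{gl}(E)$; put $\mathfrak J_0E=E$ and $\Omega^k_{\mathfrak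 JE}=\Gamma(\mathfrak J_kE)$. The higher omni-Lie algebroid is $\mathcal E=\mathcal E_n(E)=\mathfrak D E\oplus\mathfrak J_nE$ with the $\mathfrak J_{n-1}E$-valued pairing $(\mathfrak d+\mu,\mathfrak r+\nu)_+=\tfrac12(\iota_{\mathfrak d}\nu+\iota_{\mathfrak r}\mu)$ and the bracket $\{\mathfrak d+\mu,\mathfrak r+\nu\}=[\mathfrak d,\mathfrak r]+\mathfrak L_{\mathfrak d}\nu-\iota_{\mathfrak r}\mathbb d\mu$ on sections. A subbundle $L\subset\mathcal E$ is isotropic if $(\cdot,\cdot)_+$ vanishes on $L$, maximal isotropic if it is maximal (for inclusion) among isotropic subbundles, involutive if $\Gamma(L)$ is closed under $\{\cdot,\cdot\}$, and a higher Dirac–Jacobi structure if it is maximal isotropic and involutive. For $\mu\in\Omega^{n+1}_{\mathfrak JE}$ let $B_\mu:\mathfrak D E\to\mathfrak J_nE$, $\mathfrak d\mapsto\iota_{\mathfrak d}\mu$. Theorem. (1) For every $\mu\in\Omega^{n+1}_{\mathfrak JE}$ the graph of $B_\mu$ is a maximal isotropic subbundle of $\mathcal E$, and it projects isomorphically onto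 $\mathfrak D E$. (2) Every isotropic subbundle $L\subset\mathcal E$ that projects isomorphically onto $\mathfrak D E$ is the graph of $B_\mu$ for a unique $\mu\in\Omega^{n+1}_{\mathfrak JE}$. (3) For $\mu\in\Omega^{n+1}_{\mathfrak JE}$, the graph of $B_\mu$ is involutive if and only if $\mathbb d\mu=0$; equivalently, it is a higher Dirac–Jacobi structure if and only if $\mathbb d\mu=0$. Moreover $\mathbb d\mu=0$ if and only if $\mu=\mathbb d\eta$ for some $\eta\in\Omega^n_{\mathfrak JE}$. (4) For $\nu\in\Omega^n(M,E)$, the form $\mathbb d\,\mathbb j^*\nu$ lies in $\Omega^{n+1}_{\mathfrak JE}$, and $\nu\mapsto\operatorname{graph}B_{\mathbb d\,\mathbb j^*\nu}$ is a bijection from the set $\Omega^n(M,E)$ of $E$-valued $n$-forms on $M$ onto the set of higher Dirac–Jacobi structures in $\mathcal E_n(E)$ that project isomorphically onto $\mathfrak D E$. -/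

import Mathlib

open Bundle
open scoped Manifold ContDiff

noncomputable section

namespace OmniLie

/-! ## Setting

`M` is a smooth manifold modelled on the finite-dimensional real vector space `B`, and `E` is a
smooth real vector bundle over `M` with typical fibre `F`. -/

section Vector

variable {B : Type*} [NormedAddCommGroup B] [NormedSpace ℝ B]
  {M : Type*} [TopologicalSpace M] [ChartedSpace B M]

/-- Smooth vector fields on `M`. -/
abbrev VField (B : Type*) [NormedAddCommGroup B] [NormedSpace ℝ B]
    (M : Type*) [TopologicalSpace M] [ChartedSpace B M] [IsManifold 𝓘(ℝ, B) ∞ M] :=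
  Cₛ^∞⟮𝓘(ℝ, B); B, (TangentSpace 𝓘(ℝ, B) : M → Type _)⟯

/-- The derivative of a smooth function along a smooth vector field is smooth. -/
theorem contMDiff_mvfderiv_apply [IsManifold 𝓘(ℝ, B) ∞ M] {f : M → ℝ}
    (hf : ContMDiff 𝓘(ℝ, B) 𝓘(ℝ, ℝ) ∞ f) {V : ∀ x : M, TangentSpace 𝓘(ℝ, B) x}
    (hV : ContMDiff 𝓘(ℝ, B) 𝓘(ℝ, B).tangent ∞ (fun x => (TotalSpace.mk' B x (V x)))) :
    ContMDiff 𝓘(ℝ, B) 𝓘(ℝ, ℝ) ∞ (fun x => mvfderiv 𝓘(ℝ, B) f x (V x)) := by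
  have h1 : ContMDiff 𝓘(ℝ, B).tangent 𝓘(ℝ, ℝ).tangent ∞ (tangentMap 𝓘(ℝ, B) 𝓘(ℝ, ℝ) f) :=
    hf.contMDiff_tangentMap (by simp)
  exact (contMDiff_snd_tangentBundle_modelSpace ℝ 𝓘(ℝ, ℝ)).comp (h1.comp hV)

/-- The Lie bracket of vector fields acts on smooth functions as the commutator. -/
theorem mvfderiv_mlieBracket [IsManifold 𝓘(ℝ, B) ∞ M] [CompleteSpace B] {f : M → ℝ}
    (hf : ContMDiff 𝓘(ℝ, B) 𝓘(ℝ, ℝ) ∞ f) {V W : ∀ x : M, TangentSpace 𝓘(ℝ, B) x}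
    (hV : ContMDiff 𝓘(ℝ, B) 𝓘(ℝ, B).tangent ∞ (fun x => (TotalSpace.mk' B x (V x))))
    (hW : ContMDiff 𝓘(ℝ, B) 𝓘(ℝ, B).tangent ∞ (fun x => (TotalSpace.mk' B x (W x)))) (x : M) :
    mvfderiv 𝓘(ℝ, B) f x (VectorField.mlieBracket 𝓘(ℝ, B) V W x) =
      mvfderiv 𝓘(ℝ, B) (fun y => mvfderiv 𝓘(ℝ, B) f y (W y)) x (V x) -
        mvfderiv 𝓘(ℝ, B) (fun y => mvfderiv 𝓘(ℝ, B) f y (V y)) x (W x) := by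
  by_cases hx : ∀ v : TangentSpace 𝓘(ℝ, B) x, v = 0
  · rw [hx (VectorField.mlieBracket 𝓘(ℝ, B) V W x), hx (V x), hx (W x)]
    simp
  push Not at hx
  obtain ⟨z, hz⟩ := hx
  have le3 : minSmoothness ℝ 3 ≤ (∞ : WithTop ℕ∞) := by
    rw [minSmoothness_of_isRCLikeNormedField]
    exact ENat.LEInfty.out
  have le2 : minSmoothness ℝ 2 ≤ (∞ : WithTop ℕ∞) := by
    rw [minSmoothness_of_isRCLikeNormedField]
    exact ENat.LEInfty.out
  have : IsManifold 𝓘(ℝ, B) (minSmoothness ℝ 3) M := IsManifold.of_le le3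
  have : IsManifold 𝓘(ℝ, B) (((⊤ : ℕ∞) : WithTop ℕ∞) + 1) M := by simpa
  set Z : ∀ y : M, TangentSpace 𝓘(ℝ, B) y := FiberBundle.extend B z with hZdef
  have hZx : Z x = z := by simp [hZdef]
  have hZ : ContMDiffAt 𝓘(ℝ, B) 𝓘(ℝ, B).tangent ∞ (fun y => (TotalSpace.mk' B y (Z y))) x :=
    FiberBundle.contMDiffAt_extend 𝓘(ℝ, B) B z
  have hZev : ∀ᶠ y in nhds x,
      MDifferentiableAt 𝓘(ℝ, B) 𝓘(ℝ, B).tangent (fun y => (TotalSpace.mk' B y (Z y))) y := by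
    obtain ⟨s, hs, h⟩ := FiberBundle.exists_contMDiffOn_extend (k := ∞) 𝓘(ℝ, B) B z
    filter_upwards [eventually_mem_nhds_iff.2 hs] with y hy
    exact (h.contMDiffAt hy).mdifferentiableAt (by simp)
  have key : ∀ {P Q : ∀ y : M, TangentSpace 𝓘(ℝ, B) y},
      ContMDiff 𝓘(ℝ, B) 𝓘(ℝ, B).tangent ∞ (fun y => (TotalSpace.mk' B y (P y))) →
      ContMDiff 𝓘(ℝ, B) 𝓘(ℝ, B).tangent ∞ (fun y => (TotalSpace.mk' B y (Q y))) →
      VectorField.mlieBracket 𝓘(ℝ, B) P (VectorField.mlieBracket 𝓘(ℝ, B) Q (f • Z)) x =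
        (mvfderiv 𝓘(ℝ, B) (fun y => mvfderiv 𝓘(ℝ, B) f y (Q y)) x (P x) • Z x +
          mvfderiv 𝓘(ℝ, B) f x (Q x) • VectorField.mlieBracket 𝓘(ℝ, B) P Z x) +
        (mvfderiv 𝓘(ℝ, B) f x (P x) • VectorField.mlieBracket 𝓘(ℝ, B) Q Z x +
          f x • VectorField.mlieBracket 𝓘(ℝ, B) P (VectorField.mlieBracket 𝓘(ℝ, B) Q Z) x) := by
    intro P Q hP hQ
    have hQf := contMDiff_mvfderiv_apply hf hQ
    have e : VectorField.mlieBracket 𝓘(ℝ, B) Q (f • Z) =ᶠ[nhds x]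
        ((fun y => mvfderiv 𝓘(ℝ, B) f y (Q y)) • Z + f • VectorField.mlieBracket 𝓘(ℝ, B) Q Z) := by
      filter_upwards [hZev] with y hy
      exact VectorField.mlieBracket_smul_right (hf.mdifferentiableAt (by simp)) hy
    have hQZ : MDifferentiableAt 𝓘(ℝ, B) 𝓘(ℝ, B).tangent
        (fun y => (TotalSpace.mk' B y (VectorField.mlieBracket 𝓘(ℝ, B) Q Z y))) x :=
      (ContMDiffAt.mlieBracket_vectorField (m := ⊤) (n := ⊤) (hQ x) hZ (by simp)).mdifferentiableAt
        (by simp)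
    have hZ1 := hZ.mdifferentiableAt (by simp : (∞ : WithTop ℕ∞) ≠ 0)
    rw [Filter.EventuallyEq.mlieBracket_vectorField_eq (Filter.EventuallyEq.refl _ P) e,
      VectorField.mlieBracket_add_right, VectorField.mlieBracket_smul_right,
      VectorField.mlieBracket_smul_right]
    · exact hf.mdifferentiableAt (by simp)
    · exact hQZ
    · exact hQf.mdifferentiableAt (by simp)
    · exact hZ1
    · exact MDifferentiableAt.smul_section (hQf.mdifferentiableAt (by simp)) hZ1
    · exact MDifferentiableAt.smul_section (hf.mdifferentiableAt (by simp)) hQZ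
  have hfZ : ContMDiffAt 𝓘(ℝ, B) 𝓘(ℝ, B).tangent ∞ (fun y => (TotalSpace.mk' B y ((f • Z) y))) x :=
    (hf x).smul_section hZ
  have J1 := VectorField.leibniz_identity_mlieBracket_apply (I := 𝓘(ℝ, B)) (x := x)
    ((hV x).of_le le2) ((hW x).of_le le2) (hZ.of_le le2)
  have J2 := VectorField.leibniz_identity_mlieBracket_apply (I := 𝓘(ℝ, B)) (x := x)
    ((hV x).of_le le2) ((hW x).of_le le2) (hfZ.of_le le2)
  rw [key hV hW, key hW hV, VectorField.mlieBracket_smul_right (hf.mdifferentiableAt (by simp))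
    (hZ.mdifferentiableAt (by simp)), J1, hZx] at J2
  refine smul_left_injective ℝ hz ?_
  simp only [sub_smul]
  rw [smul_add] at J2
  have J3 := sub_eq_zero.2 J2
  rw [← sub_eq_zero, ← neg_eq_zero, ← J3]
  module

end Vector

variable (B : Type*) [NormedAddCommGroup B] [NormedSpace ℝ B]
  {M : Type*} [TopologicalSpace M] [ChartedSpace B M] [IsManifold 𝓘(ℝ, B) ∞ M]
  (F : Type*) [NormedAddCommGroup F] [NormedSpace ℝ F]
  (E : M → Type*) [TopologicalSpace (TotalSpace F E)]
  [∀ x, AddCommGroup (E x)] [∀ x, Module ℝ (E x)] [∀ x, TopologicalSpace (E x)]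
  [FiberBundle F E] [VectorBundle ℝ F E]

/-- `Γ(E)`: smooth sections of `E`. -/
abbrev Sec := Cₛ^∞⟮𝓘(ℝ, B); F, E⟯

variable {B F E} in
/-- The product of a smooth function and a smooth section. -/
def funSmul (f : C^∞⟮𝓘(ℝ, B), M; ℝ⟯) (u : Sec B F E) : Sec B F E :=
  ⟨fun x => f x • u x, f.contMDiff.smul_section u.contMDiff⟩

/-! ## The gauge algebroid `𝔇E` -/

/-- The fibre `𝔇ₓE` of the gauge algebroid at `x`: pairs consisting of an `ℝ`-linear map
`δ : Γ(E) → Eₓ` and a tangent vector `v ∈ TₓM`, the symbol of `δ`, which satisfy the Leibniz rule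
`δ (f u) = v(f) u(x) + f(x) δ u`. (If `E` has positive rank, then `v` is determined by `δ`.) -/
def gaugeFiber (x : M) : Submodule ℝ ((Sec B F E →ₗ[ℝ] E x) × TangentSpace 𝓘(ℝ, B) x) where
  carrier := {δ | ∀ (f : C^∞⟮𝓘(ℝ, B), M; ℝ⟯) (u : Sec B F E),
    δ.1 (funSmul f u) = mvfderiv 𝓘(ℝ, B) f x δ.2 • u x + f x • δ.1 u}
  add_mem' := by
    intro a b ha hb f u
    simp only [Prod.fst_add, Prod.snd_add, LinearMap.add_apply, map_add, ha f u, hb f u]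
    module
  zero_mem' := by
    intro f u
    simp
  smul_mem' := by
    intro c a ha f u
    simp only [Prod.smul_fst, Prod.smul_snd, LinearMap.smul_apply, map_smul, ha f u, smul_eq_mul]
    module

variable {B F E}

/-- The action of an element of `𝔇ₓE` on sections of `E`. -/
def act {x : M} (δ : gaugeFiber B F E x) (u : Sec B F E) : E x := δ.1.1 u

/-- The anchor (symbol map) `𝕛 : 𝔇ₓE → TₓM`. -/
def anchor (x : M) : gaugeFiber B F E x →ₗ[ℝ] TangentSpace 𝓘(ℝ, B) x :=
  LinearMap.snd ℝ _ _ ∘ₗ (gaugeFiber B F E x).subtype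

/-- The inclusion `gl(Eₓ) → 𝔇ₓE`; an endomorphism `Φ` acts by `u ↦ Φ (u x)`. -/
def ofEnd {x : M} (Φ : E x →ₗ[ℝ] E x) : gaugeFiber B F E x :=
  ⟨({ toFun := fun u => Φ (u x)
      map_add' := by intro u v; simp
      map_smul' := by intro c u; simp }, 0), by
    intro f u
    simp [funSmul]⟩

variable (B F E) in
/-- `Γ(𝔇E)`: smooth sections of the gauge algebroid, i.e. smooth families of elements
`δₓ ∈ 𝔇ₓE`. They are the derivations of `E` (with their symbols). -/
@[ext]
structure GaugeSec where
  toFun : ∀ x : M, gaugeFiber B F E x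
  smooth_act : ∀ u : Sec B F E, ContMDiff 𝓘(ℝ, B) (𝓘(ℝ, B).prod 𝓘(ℝ, F)) ∞
    (fun x => TotalSpace.mk' F x (act (toFun x) u))
  smooth_anchor : ContMDiff 𝓘(ℝ, B) 𝓘(ℝ, B).tangent ∞
    (fun x => (TotalSpace.mk' B x (anchor x (toFun x))))

/-- A section of `𝔇E` as an operator `Γ(E) → Γ(E)`. -/
def GaugeSec.op (δ : GaugeSec B F E) (u : Sec B F E) : Sec B F E :=
  ⟨fun x => act (δ.toFun x) u, δ.smooth_act u⟩

/-- The derivative of a smooth function along the symbol of a section of `𝔇E`. -/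
def GaugeSec.deriv (δ : GaugeSec B F E) (f : C^∞⟮𝓘(ℝ, B), M; ℝ⟯) :
    C^∞⟮𝓘(ℝ, B), M; ℝ⟯ :=
  ⟨fun x => mvfderiv 𝓘(ℝ, B) f x (anchor x (δ.toFun x)),
    contMDiff_mvfderiv_apply f.contMDiff δ.smooth_anchor⟩

theorem GaugeSec.op_funSmul (δ : GaugeSec B F E)
    (f : C^∞⟮𝓘(ℝ, B), M; ℝ⟯) (u : Sec B F E) :
    δ.op (funSmul f u) = funSmul (δ.deriv f) u + funSmul f (δ.op u) := by
  ext x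
  exact (δ.toFun x).2 f u

section Bracket

variable [FiniteDimensional ℝ B]

/-- The Lie bracket on `Γ(𝔇E)`: the commutator of derivations. -/
def gaugeBracket (δ ε : GaugeSec B F E) : GaugeSec B F E where
  toFun x :=
    ⟨({ toFun := fun u => act (δ.toFun x) (ε.op u) - act (ε.toFun x) (δ.op u)
        map_add' := by
          intro u v
          have h1 : ∀ η : GaugeSec B F E, η.op (u + v) = η.op u + η.op v := by
            intro η
            ext y
            exact map_add (η.toFun y).1.1 u v
          simp only [act, h1, map_add]
          abel
        map_smul' := by
          intro c u
          have h1 : ∀ η : GaugeSec B F E, η.op (c • u) = c • η.op u := by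
            intro η
            ext y
            exact map_smul (η.toFun y).1.1 c u
          simp only [act, h1, map_smul, RingHom.id_apply, smul_sub] },
      VectorField.mlieBracket 𝓘(ℝ, B) (fun y => anchor y (δ.toFun y))
        (fun y => anchor y (ε.toFun y)) x), by
      intro f u
      have : CompleteSpace B := FiniteDimensional.complete ℝ B
      have h := mvfderiv_mlieBracket f.contMDiff δ.smooth_anchor ε.smooth_anchor x
      have key : ∀ η θ : GaugeSec B F E, act (η.toFun x) (θ.op (funSmul f u)) =
          (mvfderiv 𝓘(ℝ, B) (fun y => mvfderiv 𝓘(ℝ, B) f y (anchor y (θ.toFun y))) x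
            (anchor x (η.toFun x)) • u x +
            mvfderiv 𝓘(ℝ, B) f x (anchor x (θ.toFun x)) • act (η.toFun x) u) +
          (mvfderiv 𝓘(ℝ, B) f x (anchor x (η.toFun x)) • act (θ.toFun x) u +
            f x • act (η.toFun x) (θ.op u)) := by
        intro η θ
        rw [GaugeSec.op_funSmul, act, map_add]
        exact congrArg₂ (· + ·) ((η.toFun x).2 (θ.deriv f) u) ((η.toFun x).2 f (θ.op u))
      simp only [LinearMap.coe_mk, AddHom.coe_mk]
      rw [key, key, h]
      module⟩
  smooth_act u := (δ.op (ε.op u) - ε.op (δ.op u)).contMDiff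
  smooth_anchor := by
    have : CompleteSpace B := FiniteDimensional.complete ℝ B
    have : IsManifold 𝓘(ℝ, B) (((⊤ : ℕ∞) : WithTop ℕ∞) + 1) M := by simpa
    have : IsManifold 𝓘(ℝ, B) (minSmoothness ℝ 3) M := by
      rw [minSmoothness_of_isRCLikeNormedField]
      exact IsManifold.of_le (n := ∞) ENat.LEInfty.out
    have : IsManifold 𝓘(ℝ, B) (minSmoothness ℝ 2) M := by
      rw [minSmoothness_of_isRCLikeNormedField]
      exact IsManifold.of_le (n := ∞) ENat.LEInfty.out
    exact fun x => ContMDiffAt.mlieBracket_vectorField (m := ⊤) (n := ⊤)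
      (δ.smooth_anchor x) (ε.smooth_anchor x) (by simp)

end Bracket

/-! ## Forms on the gauge algebroid and vector bundle forms -/

/-- The fibre `(𝔍ₖE)ₓ ⊆ Hom(∧ᵏ𝔇ₓE, Eₓ)`: for `k ≥ 1`, those `μ` for which there is
`λ ∈ Hom(∧ᵏ⁻¹TₓM, Eₓ)` with `ι_Φ μ = Φ ∘ 𝕛^*λ` for all `Φ ∈ gl(Eₓ)`.
In degree `0` there is no condition. -/
def jetFiber : (k : ℕ) → (x : M) → Submodule ℝ (gaugeFiber B F E x [⋀^Fin k]→ₗ[ℝ] E x)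
  | 0, _ => ⊤
  | k + 1, x =>
    { carrier := {μ | ∃ l : TangentSpace 𝓘(ℝ, B) x [⋀^Fin k]→ₗ[ℝ] E x,
        ∀ (Φ : E x →ₗ[ℝ] E x) (δ : Fin k → gaugeFiber B F E x),
          μ (Matrix.vecCons (ofEnd Φ) δ) = Φ (l (fun i => anchor x (δ i)))}
      add_mem' := by
        rintro a b ⟨l, hl⟩ ⟨l', hl'⟩
        exact ⟨l + l', fun Φ δ => by simp [hl, hl']⟩
      zero_mem' := ⟨0, fun Φ δ => by simp⟩
      smul_mem' := by
        rintro c a ⟨l, hl⟩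
        exact ⟨c • l, fun Φ δ => by simp [hl]⟩ }

/-- Contraction with an element of `𝔇ₓE` maps `𝔍ₖ₊₁E` to `𝔍ₖE`. -/
theorem curryLeft_mem_jetFiber : {k : ℕ} → {x : M} →
    {μ : gaugeFiber B F E x [⋀^Fin (k + 1)]→ₗ[ℝ] E x} → μ ∈ jetFiber (k + 1) x →
    (δ : gaugeFiber B F E x) → μ.curryLeft δ ∈ jetFiber k x
  | 0, _, _, _, _ => Submodule.mem_top
  | k + 1, x, μ, ⟨l, hl⟩, δ => by
    refine ⟨-(l.curryLeft (anchor x δ)), fun Φ ε => ?_⟩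
    have hswap : Matrix.vecCons δ (Matrix.vecCons (ofEnd Φ) ε) =
        Matrix.vecCons (ofEnd Φ) (Matrix.vecCons δ ε) ∘ Equiv.swap 0 1 := by
      funext i
      refine Fin.cases ?_ (fun j => ?_) i
      · simp
      · refine Fin.cases ?_ (fun j' => ?_) j
        · simp
        · rw [Function.comp_apply, Equiv.swap_apply_of_ne_of_ne]
          · simp
          · simp
          · exact Fin.succ_succ_ne_one j'
    rw [AlternatingMap.curryLeft_apply_apply, hswap, AlternatingMap.map_swap _ _ (by simp), hl]
    simp only [AlternatingMap.neg_apply, AlternatingMap.curryLeft_apply_apply, map_neg, neg_inj]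
    congr 2
    funext i
    refine Fin.cases ?_ (fun j => ?_) i <;> simp

/-- For `μ ∈ (𝔍ₖ₊₁E)ₓ`, the contraction `𝔇ₓE → (𝔍ₖE)ₓ`, `δ ↦ ι_δ μ`. -/
def contract {k : ℕ} {x : M} (μ : jetFiber (B := B) (F := F) (E := E) (k + 1) x) :
    gaugeFiber B F E x →ₗ[ℝ] jetFiber (B := B) (F := F) (E := E) k x :=
  μ.1.curryLeft.codRestrict _ (fun δ => curryLeft_mem_jetFiber μ.2 δ)

variable (B F E) in
/-- `Ωᵏ(𝔇E, E)`: smooth sections of `Hom(∧ᵏ𝔇E, E)`. -/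
@[ext]
structure GaugeForm (k : ℕ) where
  toFun : ∀ x : M, gaugeFiber B F E x [⋀^Fin k]→ₗ[ℝ] E x
  smooth : ∀ δ : Fin k → GaugeSec B F E, ContMDiff 𝓘(ℝ, B) (𝓘(ℝ, B).prod 𝓘(ℝ, F)) ∞
    (fun x => TotalSpace.mk' F x (toFun x (fun i => (δ i).toFun x)))

/-- The value `μ(δ₁, …, δₖ) ∈ Γ(E)` of a form on sections of `𝔇E`. -/
def GaugeForm.eval {k : ℕ} (μ : GaugeForm B F E k) (δ : Fin k → GaugeSec B F E) : Sec B F E :=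
  ⟨fun x => μ.toFun x (fun i => (δ i).toFun x), μ.smooth δ⟩

variable (B F E) in
/-- `Ωᵏ_{𝔍E} = Γ(𝔍ₖE)`: vector bundle forms. -/
@[ext]
structure JetForm (k : ℕ) extends GaugeForm B F E k where
  mem : ∀ x : M, toFun x ∈ jetFiber k x

/-- The value of a vector bundle form at a point. -/
def JetForm.at {k : ℕ} (μ : JetForm B F E k) (x : M) :
    jetFiber (B := B) (F := F) (E := E) k x :=
  ⟨μ.toFun x, μ.mem x⟩

section Calculus

variable [FiniteDimensional ℝ B]

/-- The de Rham differential of `𝔇E` with coefficients in `E`, on sections: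
`dμ(δ₀, …, δₖ) = ∑ᵢ (-1)ⁱ δᵢ(μ(…, δ̂ᵢ, …)) + ∑_{i<j} (-1)^{i+j} μ([δᵢ, δⱼ], …, δ̂ᵢ, …, δ̂ⱼ, …)`.
For `i < j` we have `j.succAbove i = i`, so that `l ↦ j.succAbove (i.succAbove l)` is the
increasing enumeration of the indices different from `i` and `j`. -/
def deRham : {k : ℕ} → GaugeForm B F E k → (Fin (k + 1) → GaugeSec B F E) → Sec B F E
  | 0, μ, δ => (δ 0).op (μ.eval Fin.elim0)
  | k + 1, μ, δ =>
    ∑ i : Fin (k + 2), (-1 : ℝ) ^ (i : ℕ) • (δ i).op (μ.eval (fun l => δ (i.succAbove l))) +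
    ∑ j : Fin (k + 2), ∑ i : Fin (k + 1), if i.castSucc < j then
      (-1 : ℝ) ^ ((i : ℕ) + (j : ℕ)) • μ.eval (Matrix.vecCons (gaugeBracket (δ i.castSucc) (δ j))
        (fun l => δ (j.succAbove (i.succAbove l)))) else 0

/-- The Lie derivative `𝔏_δ μ`, on sections:
`(𝔏_δ μ)(ε₁, …, εₖ) = δ(μ(ε₁, …, εₖ)) - ∑ᵢ μ(ε₁, …, [δ, εᵢ], …, εₖ)`. -/
def lieDeriv {k : ℕ} (δ : GaugeSec B F E) (μ : GaugeForm B F E k)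
    (ε : Fin k → GaugeSec B F E) : Sec B F E :=
  δ.op (μ.eval ε) - ∑ i, μ.eval (Function.update ε i (gaugeBracket δ (ε i)))

/-- `dμ = 0`. -/
def JetForm.Closed {k : ℕ} (μ : JetForm B F E k) : Prop :=
  ∀ δ, deRham μ.toGaugeForm δ = 0

/-- `μ = dη` for some vector bundle form `η`. -/
def JetForm.Exact {k : ℕ} (μ : JetForm B F E (k + 1)) : Prop :=
  ∃ η : JetForm B F E k, ∀ δ, μ.eval δ = deRham η.toGaugeForm δ

end Calculus

/-! ## The higher omni-Lie algebroid -/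

variable (B F E) in
/-- The fibre of `𝓔ₙ(E) = 𝔇E ⊕ 𝔍ₙE` at `x`. -/
abbrev OmniFiber (n : ℕ) (x : M) : Type _ :=
  gaugeFiber B F E x × jetFiber (B := B) (F := F) (E := E) n x

/-- The `𝔍ₙ₋₁E`-valued pairing `(δ + μ, ε + ν)₊ = (ι_δ ν + ι_ε μ) / 2` on `𝓔ₙ(E)`, where the
positive integer `n` is written as `m + 1`. -/
def pairing {m : ℕ} {x : M} (a b : OmniFiber B F E (m + 1) x) :
    jetFiber (B := B) (F := F) (E := E) m x :=
  (1 / 2 : ℝ) • (contract b.2 a.1 + contract a.2 b.1)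

variable (B F E) in
/-- `Γ(𝓔ₙ(E))`. -/
structure OmniSec (n : ℕ) where
  fst : GaugeSec B F E
  snd : JetForm B F E n

/-- The value of a section of `𝓔ₙ(E)` at a point. -/
def OmniSec.at {n : ℕ} (e : OmniSec B F E n) (x : M) : OmniFiber B F E n x :=
  (e.fst.toFun x, e.snd.at x)

variable (B F E) in
/-- Families of subspaces `Lₓ ⊆ 𝓔ₙ(E)ₓ`. -/
abbrev SubFamily (n : ℕ) : Type _ := ∀ x : M, Submodule ℝ (OmniFiber B F E n x)

/-- `e ∈ Γ(L)`. -/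
def OmniSec.IsIn {n : ℕ} (e : OmniSec B F E n) (L : SubFamily B F E n) : Prop :=
  ∀ x, e.at x ∈ L x

/-- `L` is a smooth vector subbundle: near each point it has a smooth frame. -/
def IsSubbundle {n : ℕ} (L : SubFamily B F E n) : Prop :=
  ∀ x₀ : M, ∃ U ∈ nhds x₀, ∃ (r : ℕ) (e : Fin r → OmniSec B F E n), ∀ x ∈ U,
    LinearIndependent ℝ (fun i => (e i).at x) ∧
    Submodule.span ℝ (Set.range (fun i => (e i).at x)) = L x

/-- `L` is isotropic. -/
def IsIsotropic {m : ℕ} (L : SubFamily B F E (m + 1)) : Prop :=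
  ∀ x, ∀ a ∈ L x, ∀ b ∈ L x, pairing a b = 0

/-- `L` is a maximal isotropic subbundle: an isotropic subbundle that is not properly contained
in an isotropic subbundle. -/
def IsMaximalIsotropic {m : ℕ} (L : SubFamily B F E (m + 1)) : Prop :=
  (IsSubbundle L ∧ IsIsotropic L) ∧
    ∀ L' : SubFamily B F E (m + 1), IsSubbundle L' → IsIsotropic L' → (∀ x, L x ≤ L' x) → L' = L

/-- The projection of `L` to `𝔇E` is an isomorphism; for a smooth bundle map over the identity
this means that it is bijective in each fibre. -/
def ProjectsIsomorphically {n : ℕ} (L : SubFamily B F E n) : Prop :=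
  ∀ x, Function.Bijective (fun e : L x => e.1.1)

section Dorfman

variable [FiniteDimensional ℝ B]

/-- `e` is the higher Dorfman bracket `{e₁, e₂}`: with `e₁ = δ + μ` and `e₂ = ε + ν`,
`{e₁, e₂} = [δ, ε] + 𝔏_δ ν - ι_ε dμ`. -/
def IsDorfmanBracket {n : ℕ} (e₁ e₂ e : OmniSec B F E n) : Prop :=
  e.fst = gaugeBracket e₁.fst e₂.fst ∧
  ∀ η : Fin n → GaugeSec B F E, e.snd.eval η =
    lieDeriv e₁.fst e₂.snd.toGaugeForm η -
      deRham e₁.snd.toGaugeForm (Matrix.vecCons e₂.fst η)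

/-- `L` is involutive: `{e₁, e₂} ∈ Γ(L)` for all `e₁, e₂ ∈ Γ(L)`. -/
def IsInvolutive {n : ℕ} (L : SubFamily B F E n) : Prop :=
  ∀ e₁ e₂ : OmniSec B F E n, e₁.IsIn L → e₂.IsIn L →
    ∃ e : OmniSec B F E n, IsDorfmanBracket e₁ e₂ e ∧ e.IsIn L

/-- Higher Dirac–Jacobi structures: maximal isotropic and involutive subbundles. -/
def IsHigherDiracJacobi {m : ℕ} (L : SubFamily B F E (m + 1)) : Prop :=
  IsMaximalIsotropic L ∧ IsInvolutive L

end Dorfman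

/-- The graph of `B_μ : 𝔇E → 𝔍ₙE`, `δ ↦ ι_δ μ`. -/
def graphB {n : ℕ} (μ : JetForm B F E (n + 1)) : SubFamily B F E n :=
  fun x => (contract (μ.at x)).graph

/-! ## `E`-valued forms on `M` -/

variable (B F E) in
/-- `Ωᵏ(M, E)`: smooth sections of `Hom(∧ᵏTM, E)`. -/
@[ext]
structure ValuedForm (k : ℕ) where
  toFun : ∀ x : M, TangentSpace 𝓘(ℝ, B) x [⋀^Fin k]→ₗ[ℝ] E x
  smooth : ∀ X : Fin k → VField B M, ContMDiff 𝓘(ℝ, B) (𝓘(ℝ, B).prod 𝓘(ℝ, F)) ∞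
    (fun x => TotalSpace.mk' F x (toFun x (fun i => X i x)))

/-- The pullback `𝕛^*ν ∈ Ωᵏ(𝔇E, E)` of an `E`-valued form along the anchor. -/
def ValuedForm.pullback {k : ℕ} (ν : ValuedForm B F E k) :
    GaugeForm B F E k where
  toFun x := (ν.toFun x).compLinearMap (anchor x)
  smooth δ := ν.smooth (fun i => ⟨fun x => anchor x ((δ i).toFun x), (δ i).smooth_anchor⟩)

end OmniLie

end

open OmniLie

/-!
Derivations of `E` form a Lie algebra under the commutator, which acts on the sections of `E`, and
the de Rham complex of the gauge algebroid is the subcomplex of tensorial cochains in the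
Chevalley–Eilenberg complex of this Lie algebra (`deRham_eq_differential`,
`IsTensorial.differential`, `IsTensorial.exists_gaugeForm`). The latter is constructed from Cartan's
formula `ι_δ d = L_δ - d ι_δ`, from which `d d = 0` follows by induction on the degree; the explicit
formula for `d` is `LieCochain.differential_apply`.

*Closed forms are exact.* The identity of `E` is a central derivation which acts as the identity on
the sections. Cartan's formula therefore reads `α = ι_Id d α + d ι_Id α`
(`LieCochain.eq_of_central`): a closed form `μ` equals `d (ι_Id μ)`. If `μ` is a section of
`𝔍ₘ₊₂E`, then `ι_Id μ = 𝕛^*ν` for a form `ν` on the base (`JetForm.exists_pullback_eq`), and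
conversely `ι_Id d 𝕛^*ν = 𝕛^*ν`, so `ν ↦ d 𝕛^*ν` is a bijection onto the closed sections.
That `d 𝕛^*ν` is a section of `𝔍ₘ₊₂E` is `ι_Φ d 𝕛^*ν = L_Φ 𝕛^*ν = Φ ∘ 𝕛^*ν`
(`ValuedForm.exists_jetForm`).

*Graphs.* The graph of a bundle map `T : 𝔇E → 𝔍ₘ₊₁E` is isotropic if and only if `T` is
skew-symmetric, and then `T` is automatically the contraction of a section of `𝔍ₘ₊₂E`
(`exists_contract_eq`). An isotropic family which contains such a graph equals it, as forms are
detected by contractions (`eq_graphB_of_le`). Smoothness is a matter of local frames: a frame of `E`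
and a frame of `TM` give a frame of `𝔇E`, which is cut off to global derivations
(`nonempty_gaugeFrame`).

*Involutivity.* By Cartan's calculus, the bracket of the sections `δ + ι_δ μ` and `ε + ι_ε μ` of the
graph is `[δ, ε] + ι_[δ, ε] μ + ι_ε ι_δ dμ` (`dorfman_contractWith`), so the graph is involutive if
and only if `dμ = 0`.
-/

/-! ### Contractions of alternating maps -/

namespace AlternatingMap

variable {R V W : Type*} [CommRing R] [AddCommGroup V] [Module R V] [AddCommGroup W] [Module R W]

theorem apply_eq_curryLeft {k : ℕ} (α : V [⋀^Fin (k + 1)]→ₗ[R] W) (v : Fin (k + 1) → V) :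
    α v = α.curryLeft (v 0) (Matrix.vecTail v) := by
  rw [curryLeft_apply_apply]
  exact congrArg α (Matrix.cons_head_tail v).symm

/-- Two alternating maps with the same contractions agree. -/
theorem ext_curryLeft {k : ℕ} {α η : V [⋀^Fin (k + 1)]→ₗ[R] W}
    (h : ∀ x, α.curryLeft x = η.curryLeft x) : α = η := by
  ext v
  rw [apply_eq_curryLeft, apply_eq_curryLeft, h]

theorem curryLeft_sub {k : ℕ} (α η : V [⋀^Fin (k + 1)]→ₗ[R] W) (x : V) :
    (α - η).curryLeft x = α.curryLeft x - η.curryLeft x := rfl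

theorem map_vecCons_swap {k : ℕ} (α : V [⋀^Fin (k + 2)]→ₗ[R] W) (x y : V) (v : Fin k → V) :
    α (Matrix.vecCons x (Matrix.vecCons y v)) = -α (Matrix.vecCons y (Matrix.vecCons x v)) := by
  have hxy := curryLeft_same α (x + y)
  have h := DFunLike.congr_fun hxy v
  have hx := DFunLike.congr_fun (curryLeft_same α x) v
  have hy := DFunLike.congr_fun (curryLeft_same α y) v
  simp only [map_add, curryLeft_add, add_apply, LinearMap.add_apply] at h
  simp only [curryLeft_apply_apply, zero_apply] at h hx hy
  rw [hx, hy, zero_add, add_zero] at h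
  rw [eq_neg_iff_add_eq_zero, add_comm]
  exact h

theorem map_eq_zero_of_curryLeft_eq_zero {k : ℕ} (α : V [⋀^Fin (k + 1)]→ₗ[R] W)
    {v : Fin (k + 1) → V} {i : Fin (k + 1)} (h : α.curryLeft (v i) = 0) : α v = 0 := by
  have h0 := DFunLike.congr_fun h (i.removeNth v)
  rw [curryLeft_apply_apply] at h0
  rw [← Fin.insertNth_self_removeNth i v, map_insertNth, h0, zero_apply, smul_zero]

/-- A linear map `T` from `V` to `(k + 1)`-forms with `ι_x (T x) = 0` is the contraction of a
`(k + 2)`-form. -/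
def uncurryLeft {k : ℕ} (T : V →ₗ[R] V [⋀^Fin (k + 1)]→ₗ[R] W)
    (h : ∀ x, (T x).curryLeft x = 0) : V [⋀^Fin (k + 2)]→ₗ[R] W where
  toMultilinearMap := LinearMap.uncurryLeft (toMultilinearMapLM ∘ₗ T)
  map_eq_zero_of_eq' := by
    have main : ∀ (v : Fin (k + 2) → V) (j : Fin (k + 1)), v 0 = v j.succ →
        T (v 0) (Fin.tail v) = 0 := by
      intro v j hj
      refine map_eq_zero_of_curryLeft_eq_zero (T (v 0)) (i := j) ?_
      rw [show Fin.tail v j = v 0 from hj.symm, h]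
    intro v i j hv hij
    change T (v 0) (Fin.tail v) = 0
    rcases Fin.eq_zero_or_eq_succ i with rfl | ⟨i, rfl⟩
    · rcases Fin.eq_zero_or_eq_succ j with rfl | ⟨j, rfl⟩
      · exact absurd rfl hij
      · exact main v j hv
    · rcases Fin.eq_zero_or_eq_succ j with rfl | ⟨j, rfl⟩
      · exact main v i hv.symm
      · exact (T (v 0)).map_eq_zero_of_eq (Fin.tail v) hv (fun h => hij (by rw [h]))

@[simp]
theorem curryLeft_uncurryLeft {k : ℕ} (T : V →ₗ[R] V [⋀^Fin (k + 1)]→ₗ[R] W)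
    (h : ∀ x, (T x).curryLeft x = 0) (x : V) : (uncurryLeft T h).curryLeft x = T x := by
  ext v
  rw [curryLeft_apply_apply]
  change T (Matrix.vecCons x v 0) (Fin.tail (Matrix.vecCons x v)) = T x v
  rfl

/-- A form which vanishes as soon as one argument lies in the kernel of `p` depends only on the
images of its arguments under `p`. -/
theorem map_congr_of_ker {U : Type*} [AddCommGroup U] [Module R U] (p : V →ₗ[R] U) :
    ∀ {k : ℕ} (α : V [⋀^Fin k]→ₗ[R] W) (_ : ∀ (v : Fin k → V) (i), p (v i) = 0 → α v = 0)
      {v w : Fin k → V} (_ : ∀ i, p (v i) = p (w i)), α v = α w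
  | 0, α, _, v, w, _ => congrArg α (Subsingleton.elim _ _)
  | k + 1, α, hα, v, w, hvw => by
    have h1 : α.curryLeft (v 0 - w 0) (Matrix.vecTail v) = 0 := by
      rw [curryLeft_apply_apply]
      exact hα _ 0 (by simp [hvw 0])
    rw [map_sub, sub_apply, sub_eq_zero] at h1
    rw [apply_eq_curryLeft α v, apply_eq_curryLeft α w, h1]
    refine map_congr_of_ker p _ (fun u i hu => ?_) (fun i => hvw i.succ)
    rw [curryLeft_apply_apply]
    exact hα _ i.succ (by simpa using hu)

/-- A form which vanishes on the kernel of a surjective linear map `p` is a pullback along `p`. -/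
theorem exists_eq_compLinearMap_of_ker {K V W U : Type*} [Field K] [AddCommGroup V] [Module K V]
    [AddCommGroup W] [Module K W] [AddCommGroup U] [Module K U] {k : ℕ} (p : V →ₗ[K] U)
    (hp : Function.Surjective p) (α : V [⋀^Fin (k + 1)]→ₗ[K] W)
    (hα : ∀ v, p v = 0 → α.curryLeft v = 0) :
    ∃ l : U [⋀^Fin (k + 1)]→ₗ[K] W, ∀ v, α v = l (fun i => p (v i)) := by
  obtain ⟨s, hs⟩ := LinearMap.exists_rightInverse_of_surjective p (LinearMap.range_eq_top.2 hp)
  refine ⟨α.compLinearMap s, fun v => ?_⟩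
  refine map_congr_of_ker p α
    (fun v i hv => α.map_eq_zero_of_curryLeft_eq_zero (i := i) (hα _ hv)) (fun i => ?_)
  exact (DFunLike.congr_fun hs (p (v i))).symm

end AlternatingMap

/-! ### The Chevalley–Eilenberg complex of a Lie algebra with coefficients in a module -/

namespace LieCochain

variable {R g V : Type*} [CommRing R] [LieRing g] [LieAlgebra R g] [AddCommGroup V] [Module R V]

theorem lieDeriv_aux {k : ℕ} (x : g) (α : g [⋀^Fin k]→ₗ[R] V) (ζ : Fin k → g) (i : Fin k) :
    α (fun j => Function.update (fun _ => (LinearMap.id : g →ₗ[R] g)) i (LieAlgebra.ad R g x) j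
      (ζ j)) = α (Function.update ζ i ⁅x, ζ i⁆) := by
  congr 1
  funext j
  by_cases h : j = i
  · subst h; simp
  · simp [h]

variable [LieRingModule g V] [LieModule R g V]

/-- The Lie derivative `L_x` of Lie algebra cochains. -/
def lieDeriv {k : ℕ} (x : g) (α : g [⋀^Fin k]→ₗ[R] V) : g [⋀^Fin k]→ₗ[R] V where
  toMultilinearMap := (LieModule.toEnd R g V x).compMultilinearMap α.toMultilinearMap -
    ∑ i, α.toMultilinearMap.compLinearMap
      (Function.update (fun _ => (LinearMap.id : g →ₗ[R] g)) i (LieAlgebra.ad R g x))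
  map_eq_zero_of_eq' := by
    intro ζ i j hζ hij
    have e : ∀ l, (α.toMultilinearMap.compLinearMap
        (Function.update (fun _ => (LinearMap.id : g →ₗ[R] g)) l (LieAlgebra.ad R g x))) ζ =
        α (Function.update ζ l ⁅x, ζ l⁆) := fun l => lieDeriv_aux x α ζ l
    have h0 : α ζ = 0 := α.map_eq_zero_of_eq ζ hζ hij
    have hs : α (Function.update ζ i ⁅x, ζ i⁆) = - α (Function.update ζ j ⁅x, ζ j⁆) := by
      rw [← α.map_swap (Function.update ζ j ⁅x, ζ j⁆) hij]
      congr 1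
      funext l
      by_cases hi : l = i
      · subst hi; simp [hζ]
      · by_cases hj : l = j
        · subst hj; simp [hi, hij, hζ]
        · simp [hi, hj, Equiv.swap_apply_of_ne_of_ne hi hj]
    simp only [MultilinearMap.toFun_eq_coe, sub_apply, sum_apply, e]
    rw [Finset.sum_eq_add_of_mem i j (Finset.mem_univ _) (Finset.mem_univ _) hij, hs]
    · simp [h0]
    · rintro l - ⟨hli, hlj⟩
      exact α.map_eq_zero_of_eq _ (by simp [hli.symm, hlj.symm, hζ]) hij

theorem lieDeriv_apply {k : ℕ} (x : g) (α : g [⋀^Fin k]→ₗ[R] V) (ζ : Fin k → g) :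
    lieDeriv x α ζ = ⁅x, α ζ⁆ - ∑ i, α (Function.update ζ i ⁅x, ζ i⁆) := by
  simp only [← lieDeriv_aux]
  simp [lieDeriv, ← AlternatingMap.coe_multilinearMap]

theorem lieDeriv_add {k : ℕ} (x : g) (α η : g [⋀^Fin k]→ₗ[R] V) :
    lieDeriv x (α + η) = lieDeriv x α + lieDeriv x η := by
  ext ζ
  simp only [lieDeriv_apply, AlternatingMap.add_apply, lie_add, Finset.sum_add_distrib]
  abel

theorem lieDeriv_smul {k : ℕ} (x : g) (c : R) (α : g [⋀^Fin k]→ₗ[R] V) :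
    lieDeriv x (c • α) = c • lieDeriv x α := by
  ext ζ
  simp only [lieDeriv_apply, AlternatingMap.smul_apply, lie_smul, smul_sub, Finset.smul_sum]

theorem lieDeriv_sub {k : ℕ} (x : g) (α η : g [⋀^Fin k]→ₗ[R] V) :
    lieDeriv x (α - η) = lieDeriv x α - lieDeriv x η := by
  ext ζ
  simp only [lieDeriv_apply, AlternatingMap.sub_apply, lie_sub, Finset.sum_sub_distrib]
  abel

theorem add_lieDeriv {k : ℕ} (x y : g) (α : g [⋀^Fin k]→ₗ[R] V) :
    lieDeriv (x + y) α = lieDeriv x α + lieDeriv y α := by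
  ext ζ
  simp only [lieDeriv_apply, AlternatingMap.add_apply, add_lie, AlternatingMap.map_update_add,
    Finset.sum_add_distrib]
  abel

theorem smul_lieDeriv {k : ℕ} (c : R) (x : g) (α : g [⋀^Fin k]→ₗ[R] V) :
    lieDeriv (c • x) α = c • lieDeriv x α := by
  ext ζ
  simp only [lieDeriv_apply, AlternatingMap.smul_apply, smul_lie, AlternatingMap.map_update_smul,
    smul_sub, Finset.smul_sum]

/-- `ι_y L_x = L_x ι_y - ι_[x, y]`. -/
theorem curryLeft_lieDeriv {k : ℕ} (x y : g) (α : g [⋀^Fin (k + 1)]→ₗ[R] V) :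
    (lieDeriv x α).curryLeft y = lieDeriv x (α.curryLeft y) - α.curryLeft ⁅x, y⁆ := by
  ext ζ
  simp only [AlternatingMap.curryLeft_apply_apply, AlternatingMap.sub_apply, lieDeriv_apply,
    Fin.sum_univ_succ]
  have h0 : Function.update (Matrix.vecCons y ζ) 0 ⁅x, Matrix.vecCons y ζ 0⁆ =
      Matrix.vecCons ⁅x, y⁆ ζ := Fin.update_cons_zero (α := fun _ => g) y ζ _
  have h1 : ∀ i : Fin k, Function.update (Matrix.vecCons y ζ) i.succ
      ⁅x, Matrix.vecCons y ζ i.succ⁆ = Matrix.vecCons y (Function.update ζ i ⁅x, ζ i⁆) :=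
    fun i => (Fin.cons_update (α := fun _ => g) y ζ i _).symm
  simp only [h0, h1]
  abel

/-- `L_x L_y - L_y L_x = L_[x, y]`. -/
theorem lieDeriv_lieDeriv (x y : g) : ∀ {k : ℕ} (α : g [⋀^Fin k]→ₗ[R] V),
    lieDeriv x (lieDeriv y α) - lieDeriv y (lieDeriv x α) = lieDeriv ⁅x, y⁆ α
  | 0, α => by
    ext ζ
    simp [lieDeriv_apply]
  | k + 1, α => by
    refine AlternatingMap.ext_curryLeft fun z => ?_
    rw [AlternatingMap.curryLeft_sub]
    simp only [curryLeft_lieDeriv, lieDeriv_sub]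
    rw [← lieDeriv_lieDeriv x y (α.curryLeft z), lie_lie]
    simp only [map_sub]
    abel

/-- The differential in degree `0`: an element `v` of `V` is mapped to `x ↦ ⁅x, v⁆`. -/
def differentialZero : (g [⋀^Fin 0]→ₗ[R] V) →ₗ[R] (g [⋀^Fin 1]→ₗ[R] V) where
  toFun α := AlternatingMap.ofSubsingleton R g V (0 : Fin 1)
    ((LieModule.toEnd R g V : g →ₗ[R] Module.End R V).flip (α ![]))
  map_add' α η := by ext; simp
  map_smul' c α := by ext; simp

theorem differentialZero_apply (α : g [⋀^Fin 0]→ₗ[R] V) (ζ : Fin 1 → g) :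
    differentialZero α ζ = ⁅ζ 0, α ![]⁆ := by
  simp [differentialZero]

/-- The map `x ↦ L_x α - d (ι_x α)`, given `d` in lower degree. -/
def differentialSucc {k : ℕ} (d : (g [⋀^Fin k]→ₗ[R] V) →ₗ[R] (g [⋀^Fin (k + 1)]→ₗ[R] V))
    (α : g [⋀^Fin (k + 1)]→ₗ[R] V) : g →ₗ[R] (g [⋀^Fin (k + 1)]→ₗ[R] V) where
  toFun x := lieDeriv x α - d (α.curryLeft x)
  map_add' x y := by
    simp only [add_lieDeriv, map_add]
    abel
  map_smul' c x := by
    simp only [smul_lieDeriv, map_smul, RingHom.id_apply, smul_sub]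

/-- The differential is constructed by recursion on the degree from Cartan's formula
`ι_x d = L_x - d ι_x`. The recursion also has to carry along the special case `ι_x d α = L_x α` if
`ι_x α = 0`, which makes the right-hand side of Cartan's formula alternating. -/
def differentialAux : (k : ℕ) → {d : (g [⋀^Fin k]→ₗ[R] V) →ₗ[R] (g [⋀^Fin (k + 1)]→ₗ[R] V) //
    ∀ (x : g) (α : g [⋀^Fin k]→ₗ[R] V), (∀ v : Fin k → g, (∃ i, v i = x) → α v = 0) →
      (d α).curryLeft x = lieDeriv x α}
  | 0 => ⟨differentialZero, fun x α _ => by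
      ext ζ
      rw [AlternatingMap.curryLeft_apply_apply, differentialZero_apply, lieDeriv_apply]
      simp [Subsingleton.elim ζ ![]]⟩
  | k + 1 => ⟨{ toFun := fun α => AlternatingMap.uncurryLeft
                  (differentialSucc (differentialAux k).1 α) (fun x => by
                    have h := (differentialAux k).2 x (α.curryLeft x) (by
                      rintro v ⟨i, hi⟩
                      rw [AlternatingMap.curryLeft_apply_apply]
                      exact α.map_eq_zero_of_eq (i := 0) (j := i.succ) _ (by simp [hi])
                        (Fin.succ_ne_zero i).symm)
                    change (lieDeriv x α).curryLeft x - ((differentialAux k).1 _).curryLeft x = 0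
                    rw [h, curryLeft_lieDeriv, lie_self, map_zero, sub_zero, sub_self])
                map_add' := fun α η => by
                  refine AlternatingMap.ext_curryLeft fun x => ?_
                  simp only [AlternatingMap.curryLeft_uncurryLeft, AlternatingMap.curryLeft_add,
                    LinearMap.add_apply]
                  simp only [differentialSucc, LinearMap.coe_mk, AddHom.coe_mk, lieDeriv_add,
                    AlternatingMap.curryLeft_add, LinearMap.add_apply, map_add]
                  abel
                map_smul' := fun c α => by
                  refine AlternatingMap.ext_curryLeft fun x => ?_
                  simp only [AlternatingMap.curryLeft_uncurryLeft, AlternatingMap.curryLeft_smul,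
                    LinearMap.smul_apply, RingHom.id_apply]
                  simp only [differentialSucc, LinearMap.coe_mk, AddHom.coe_mk, lieDeriv_smul,
                    AlternatingMap.curryLeft_smul, LinearMap.smul_apply, map_smul, smul_sub] },
      fun x α hα => by
      have h0 : α.curryLeft x = 0 := by
        ext v
        rw [AlternatingMap.curryLeft_apply_apply]
        exact hα _ ⟨0, rfl⟩
      simp [h0, differentialSucc]⟩

/-- The Chevalley–Eilenberg differential of Lie algebra cochains. -/
def differential (k : ℕ) : (g [⋀^Fin k]→ₗ[R] V) →ₗ[R] (g [⋀^Fin (k + 1)]→ₗ[R] V) :=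
  (differentialAux k).1

theorem differential_zero_apply (α : g [⋀^Fin 0]→ₗ[R] V) (ζ : Fin 1 → g) :
    differential 0 α ζ = ⁅ζ 0, α ![]⁆ :=
  differentialZero_apply α ζ

theorem curryLeft_differential_zero (x : g) (α : g [⋀^Fin 0]→ₗ[R] V) :
    (differential 0 α).curryLeft x = lieDeriv x α :=
  (differentialAux 0).2 x α (fun _ ⟨i, _⟩ => i.elim0)

/-- Cartan's formula `ι_x d = L_x - d ι_x`. -/
theorem curryLeft_differential {k : ℕ} (x : g) (α : g [⋀^Fin (k + 1)]→ₗ[R] V) :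
    (differential (k + 1) α).curryLeft x = lieDeriv x α - differential k (α.curryLeft x) := by
  simp [differential, differentialAux, differentialSucc]

theorem lieDeriv_differential (x : g) : ∀ {k : ℕ} (α : g [⋀^Fin k]→ₗ[R] V),
    lieDeriv x (differential k α) = differential k (lieDeriv x α)
  | 0, α => by
    refine AlternatingMap.ext_curryLeft fun y => ?_
    rw [curryLeft_lieDeriv]
    simp only [curryLeft_differential_zero]
    rw [← lieDeriv_lieDeriv]
    abel
  | k + 1, α => by
    refine AlternatingMap.ext_curryLeft fun y => ?_
    rw [curryLeft_lieDeriv]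
    simp only [curryLeft_differential, curryLeft_lieDeriv, lieDeriv_sub, map_sub]
    rw [← lieDeriv_lieDeriv, lieDeriv_differential x (α.curryLeft y)]
    abel

/-- `d ∘ d = 0`, by induction on the degree: by Cartan's formula and `[L_x, d] = 0`, the
contraction of `d d α` with `x` is `d d (ι_x α)`. -/
theorem differential_differential : ∀ {k : ℕ} (α : g [⋀^Fin k]→ₗ[R] V),
    differential (k + 1) (differential k α) = 0
  | 0, α => by
    refine AlternatingMap.ext_curryLeft fun x => ?_
    rw [curryLeft_differential, curryLeft_differential_zero, lieDeriv_differential, sub_self]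
    simp
  | k + 1, α => by
    refine AlternatingMap.ext_curryLeft fun x => ?_
    rw [curryLeft_differential, curryLeft_differential, lieDeriv_differential, map_sub,
      differential_differential (α.curryLeft x), sub_zero, sub_self]
    simp

/-- The homotopy formula: if `x` is central in `g` and acts on `V` as the identity, then the
contraction with `x` is a contracting homotopy. -/
theorem eq_of_central {k : ℕ} {x : g} (hx : ∀ y : g, ⁅x, y⁆ = 0) (hV : ∀ v : V, ⁅x, v⁆ = v)
    (α : g [⋀^Fin (k + 1)]→ₗ[R] V) :
    α = (differential (k + 1) α).curryLeft x + differential k (α.curryLeft x) := by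
  rw [curryLeft_differential, sub_add_cancel]
  ext ζ
  rw [lieDeriv_apply, hV, Finset.sum_eq_zero, sub_zero]
  intro i _
  rw [hx]
  exact α.map_update_zero ζ i

theorem neg_one_pow_smul_int (n : ℕ) (v : V) : (-1 : ℤ) ^ n • v = (-1 : R) ^ n • v := by
  rcases Nat.even_or_odd n with h | h <;> simp [h.neg_one_pow]

/-- The explicit formula for the Chevalley–Eilenberg differential. For `i < j`, the increasing
enumeration of the indices different from `i` and `j` is `l ↦ j.succAbove (i.succAbove l)`. -/
theorem differential_apply : ∀ {k : ℕ} (α : g [⋀^Fin (k + 1)]→ₗ[R] V) (δ : Fin (k + 2) → g),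
    differential (k + 1) α δ =
      ∑ i : Fin (k + 2), (-1 : R) ^ (i : ℕ) • ⁅δ i, α (fun l => δ (i.succAbove l))⁆ +
      ∑ j : Fin (k + 2), ∑ i : Fin (k + 1), if i.castSucc < j then
        (-1 : R) ^ ((i : ℕ) + (j : ℕ)) • α (Matrix.vecCons ⁅δ i.castSucc, δ j⁆
          (fun l => δ (j.succAbove (i.succAbove l)))) else 0 := by
  intro k
  induction k with
  | zero =>
    intro α δ
    obtain ⟨x, ζ, rfl⟩ : ∃ x ζ, δ = Matrix.vecCons x ζ :=
      ⟨_, _, (Matrix.cons_head_tail δ).symm⟩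
    rw [← AlternatingMap.curryLeft_apply_apply, curryLeft_differential, AlternatingMap.sub_apply,
      lieDeriv_apply, differential_zero_apply, AlternatingMap.curryLeft_apply_apply]
    have e1 : (fun l : Fin 1 => Matrix.vecCons x ζ (Fin.succAbove 0 l)) = ζ := by
      funext l; simp
    have e2 : (fun l : Fin 1 => Matrix.vecCons x ζ (Fin.succAbove 1 l)) = ![x] := by
      funext l; fin_cases l; simp
    have e3 : ∀ f : Fin 0 → g, Matrix.vecCons ⁅x, ζ 0⁆ f = ![⁅x, ζ 0⁆] := by
      intro f; rw [Subsingleton.elim f ![]]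
    have e4 : Function.update ζ 0 ⁅x, ζ 0⁆ = ![⁅x, ζ 0⁆] := by
      funext l; fin_cases l; simp
    simp [Fin.sum_univ_succ, e2, e3, e4]
    abel
  | succ k ih =>
    intro α δ
    obtain ⟨x, ζ, rfl⟩ : ∃ x ζ, δ = Matrix.vecCons x ζ :=
      ⟨_, _, (Matrix.cons_head_tail δ).symm⟩
    -- Induction with Cartan's formula: the sum in `L_x α` gives the brackets `⁅x, ζ i⁆`, the first
    -- term of `L_x α` the action of `x`, and `d (ι_x α)` all terms which keep `x` as an argument.
    have hL : ∑ i, α (Function.update ζ i ⁅x, ζ i⁆) = ∑ i : Fin (k + 2), (-1 : R) ^ (i : ℕ) •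
        α (Matrix.vecCons ⁅x, ζ i⁆ (fun l => ζ (i.succAbove l))) := by
      refine Finset.sum_congr rfl fun i _ => ?_
      rw [← Fin.insertNth_removeNth, AlternatingMap.map_insertNth, neg_one_pow_smul_int (R := R)]
      rfl
    have e1 : ∀ i : Fin (k + 2), (fun l => Matrix.vecCons x ζ (i.succ.succAbove l)) =
        Matrix.vecCons x (fun l => ζ (i.succAbove l)) := by
      intro i
      funext l
      refine Fin.cases ?_ (fun l => ?_) l <;> simp
    have e2 : ∀ (i : Fin (k + 1)) (j : Fin (k + 2)),
        (fun l => Matrix.vecCons x ζ (j.succ.succAbove (i.succ.succAbove l))) =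
        Matrix.vecCons x (fun l => ζ (j.succAbove (i.succAbove l))) := by
      intro i j
      funext l
      refine Fin.cases ?_ (fun l => ?_) l <;> simp
    rw [← AlternatingMap.curryLeft_apply_apply, curryLeft_differential, AlternatingMap.sub_apply,
      lieDeriv_apply, ih, hL, Fin.sum_univ_succ (n := k + 2),
      Fin.sum_univ_succ (n := k + 2) (f := fun j => ∑ i : Fin (k + 2), _)]
    -- The summand of `j + 1` splits into the bracket with `x` (where `i = 0`) and the rest.
    have e3 : ∀ j : Fin (k + 2), (∑ i : Fin (k + 2), if i.castSucc < j.succ then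
        (-1 : R) ^ ((i : ℕ) + (j.succ : ℕ)) • α (Matrix.vecCons
          ⁅Matrix.vecCons x ζ i.castSucc, Matrix.vecCons x ζ j.succ⁆
          (fun l => Matrix.vecCons x ζ (j.succ.succAbove (i.succAbove l)))) else 0) =
        -((-1 : R) ^ (j : ℕ) • α (Matrix.vecCons ⁅x, ζ j⁆ (fun l => ζ (j.succAbove l)))) -
        ∑ i : Fin (k + 1), if i.castSucc < j then
          (-1 : R) ^ ((i : ℕ) + (j : ℕ)) • α.curryLeft x (Matrix.vecCons ⁅ζ i.castSucc, ζ j⁆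
          (fun l => ζ (j.succAbove (i.succAbove l)))) else 0 := by
      intro j
      rw [Fin.sum_univ_succ, sub_eq_add_neg, ← Finset.sum_neg_distrib]
      congr 1
      · simp [pow_succ]
      · refine Finset.sum_congr rfl fun i _ => ?_
        have hc : (i.succ.castSucc < j.succ) ↔ i.castSucc < j := by
          rw [← Fin.succ_castSucc, Fin.succ_lt_succ_iff]
        have hp : (i.succ : ℕ) + (j.succ : ℕ) = (i : ℕ) + (j : ℕ) + 2 := by
          simp only [Fin.val_succ]; ring
        by_cases hij : i.castSucc < j
        · rw [if_pos (hc.2 hij), if_pos hij, e2, AlternatingMap.curryLeft_apply_apply,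
            AlternatingMap.map_vecCons_swap, hp, pow_add]
          simp
        · rw [if_neg (fun h => hij (hc.1 h)), if_neg hij, neg_zero]
    rw [Finset.sum_congr rfl fun j _ => e3 j]
    simp only [e1, Matrix.cons_val_succ, Fin.val_succ, pow_succ, mul_neg, mul_one, neg_smul,
      AlternatingMap.curryLeft_apply_apply, Finset.sum_sub_distrib, Finset.sum_neg_distrib,
      Fin.not_lt_zero, if_false, Finset.sum_const_zero, Matrix.cons_val_zero, Fin.val_zero,
      pow_zero, one_smul, Fin.zero_succAbove]
    abel

end LieCochain

noncomputable section

namespace OmniLie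

variable {B : Type*} [NormedAddCommGroup B] [NormedSpace ℝ B]
  {M : Type*} [TopologicalSpace M] [ChartedSpace B M] [IsManifold 𝓘(ℝ, B) ∞ M]
  {F : Type*} [NormedAddCommGroup F] [NormedSpace ℝ F]
  {E : M → Type*} [TopologicalSpace (TotalSpace F E)]
  [∀ x, AddCommGroup (E x)] [∀ x, Module ℝ (E x)] [∀ x, TopologicalSpace (E x)]
  [FiberBundle F E] [VectorBundle ℝ F E]

/-! ### The Lie algebra of derivations -/

/-- The symbol of a derivation, as a vector field. -/
def GaugeSec.symbol (δ : GaugeSec B F E) : VField B M :=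
  ⟨fun x => anchor x (δ.toFun x), δ.smooth_anchor⟩

namespace GaugeSec

theorem toFun_injective : Function.Injective (toFun : GaugeSec B F E → _) :=
  fun _ _ h => GaugeSec.ext h

instance : Zero (GaugeSec B F E) :=
  ⟨⟨fun _ => 0, fun _ => (0 : Sec B F E).contMDiff, by
    have h := (0 : VField B M).contMDiff
    exact h⟩⟩

instance : Add (GaugeSec B F E) :=
  ⟨fun δ ε => ⟨fun x => δ.toFun x + ε.toFun x, fun u => (δ.op u + ε.op u).contMDiff,
    (δ.symbol + ε.symbol).contMDiff⟩⟩

instance : Neg (GaugeSec B F E) :=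
  ⟨fun δ => ⟨fun x => -δ.toFun x, fun u => (-δ.op u).contMDiff, (-δ.symbol).contMDiff⟩⟩

instance : Sub (GaugeSec B F E) :=
  ⟨fun δ ε => ⟨fun x => δ.toFun x - ε.toFun x, fun u => (δ.op u - ε.op u).contMDiff,
    (δ.symbol - ε.symbol).contMDiff⟩⟩

instance : SMul ℝ (GaugeSec B F E) :=
  ⟨fun c δ => ⟨fun x => c • δ.toFun x, fun u => (c • δ.op u).contMDiff,
    (c • δ.symbol).contMDiff⟩⟩

instance : SMul ℕ (GaugeSec B F E) := ⟨nsmulRec⟩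

instance : SMul ℤ (GaugeSec B F E) := ⟨zsmulRec⟩

theorem nsmul_toFun (n : ℕ) (δ : GaugeSec B F E) : (n • δ).toFun = n • δ.toFun := by
  induction n with
  | zero => rw [zero_smul]; rfl
  | succ n ih => rw [succ_nsmul, ← ih]; rfl

instance : AddCommGroup (GaugeSec B F E) :=
  toFun_injective.addCommGroup toFun rfl (fun _ _ => rfl) (fun _ => rfl) (fun _ _ => rfl)
    (fun δ n => nsmul_toFun n δ) (fun δ n => by
      obtain n | n := n
      · exact (nsmul_toFun n δ).trans (natCast_zsmul δ.toFun n).symm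
      · rw [negSucc_zsmul, ← nsmul_toFun]; rfl)

/-- The values of a derivation, as an additive map. -/
def toFunHom : GaugeSec B F E →+ ∀ x : M, gaugeFiber B F E x where
  toFun := toFun
  map_zero' := rfl
  map_add' _ _ := rfl

instance : Module ℝ (GaugeSec B F E) :=
  toFun_injective.module ℝ toFunHom (fun _ _ => rfl)

/-- A derivation is determined by its action on sections and its symbol. The symbol is not redundant:
if the fibres of `E` are zero, the action carries no information on it. -/
theorem ext_op_symbol {δ ε : GaugeSec B F E} (h : ∀ u, δ.op u = ε.op u)
    (h' : δ.symbol = ε.symbol) : δ = ε := by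
  refine GaugeSec.ext (funext fun x => Subtype.ext (Prod.ext ?_ ?_))
  · ext u
    exact DFunLike.congr_fun (h u) x
  · exact DFunLike.congr_fun h' x

theorem op_add (δ : GaugeSec B F E) (u v : Sec B F E) : δ.op (u + v) = δ.op u + δ.op v := by
  ext x
  exact map_add (δ.toFun x).1.1 u v

theorem op_sub (δ : GaugeSec B F E) (u v : Sec B F E) : δ.op (u - v) = δ.op u - δ.op v := by
  ext x
  exact map_sub (δ.toFun x).1.1 u v

theorem op_smul (δ : GaugeSec B F E) (c : ℝ) (u : Sec B F E) : δ.op (c • u) = c • δ.op u := by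
  ext x
  exact map_smul (δ.toFun x).1.1 c u

theorem add_op (δ ε : GaugeSec B F E) (u : Sec B F E) : (δ + ε).op u = δ.op u + ε.op u := rfl

theorem smul_op (c : ℝ) (δ : GaugeSec B F E) (u : Sec B F E) : (c • δ).op u = c • δ.op u := rfl

/-- The product of a smooth function and a derivation. -/
def fmul (f : C^∞⟮𝓘(ℝ, B), M; ℝ⟯) (δ : GaugeSec B F E) : GaugeSec B F E :=
  ⟨fun x => f x • δ.toFun x, fun u => (funSmul f (δ.op u)).contMDiff,
    f.contMDiff.smul_section δ.smooth_anchor⟩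

/-- The evaluation of a derivation at a point. -/
def evalAt (x : M) : GaugeSec B F E →ₗ[ℝ] gaugeFiber B F E x where
  toFun δ := δ.toFun x
  map_add' _ _ := rfl
  map_smul' _ _ := rfl

theorem mdifferentiableAt_symbol (δ : GaugeSec B F E) (x : M) :
    MDifferentiableAt 𝓘(ℝ, B) 𝓘(ℝ, B).tangent
      (fun x => (TotalSpace.mk' B x (δ.symbol x) : TangentBundle 𝓘(ℝ, B) M)) x :=
  δ.smooth_anchor.mdifferentiableAt (by simp)

variable [FiniteDimensional ℝ B]

theorem op_gaugeBracket (δ ε : GaugeSec B F E) (u : Sec B F E) :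
    (gaugeBracket δ ε).op u = δ.op (ε.op u) - ε.op (δ.op u) := rfl

theorem symbol_gaugeBracket (δ ε : GaugeSec B F E) (x : M) :
    (gaugeBracket δ ε).symbol x = VectorField.mlieBracket 𝓘(ℝ, B) δ.symbol ε.symbol x := rfl

/-- Derivations with the commutator as bracket. On symbols, this is the Lie bracket of vector
fields. -/
instance : LieRing (GaugeSec B F E) where
  bracket := gaugeBracket
  add_lie δ ε η := by
    refine ext_op_symbol (fun u => ?_) ?_
    · change (gaugeBracket _ _).op u = (gaugeBracket _ _).op u + (gaugeBracket _ _).op u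
      simp only [op_gaugeBracket, add_op, op_add]
      abel
    · ext x
      exact VectorField.mlieBracket_add_left (δ.mdifferentiableAt_symbol x)
        (ε.mdifferentiableAt_symbol x)
  lie_add δ ε η := by
    refine ext_op_symbol (fun u => ?_) ?_
    · change (gaugeBracket _ _).op u = (gaugeBracket _ _).op u + (gaugeBracket _ _).op u
      simp only [op_gaugeBracket, add_op, op_add]
      abel
    · ext x
      exact VectorField.mlieBracket_add_right (ε.mdifferentiableAt_symbol x)
        (η.mdifferentiableAt_symbol x)
  lie_self δ := by
    refine ext_op_symbol (fun u => ?_) ?_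
    · exact sub_self (δ.op (δ.op u))
    · ext x
      exact congrFun VectorField.mlieBracket_self x
  leibniz_lie δ ε η := by
    refine ext_op_symbol (fun u => ?_) ?_
    · change (gaugeBracket _ (gaugeBracket _ _)).op u =
        (gaugeBracket (gaugeBracket _ _) _).op u + (gaugeBracket _ (gaugeBracket _ _)).op u
      simp only [op_gaugeBracket, op_sub]
      abel
    · ext x
      have : CompleteSpace B := FiniteDimensional.complete ℝ B
      have le3 : minSmoothness ℝ 3 ≤ (∞ : WithTop ℕ∞) := by
        rw [minSmoothness_of_isRCLikeNormedField]
        exact ENat.LEInfty.out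
      have le2 : minSmoothness ℝ 2 ≤ (∞ : WithTop ℕ∞) := by
        rw [minSmoothness_of_isRCLikeNormedField]
        exact ENat.LEInfty.out
      have : IsManifold 𝓘(ℝ, B) (minSmoothness ℝ 3) M := IsManifold.of_le le3
      exact VectorField.leibniz_identity_mlieBracket_apply (I := 𝓘(ℝ, B)) (x := x)
        ((δ.smooth_anchor x).of_le le2) ((ε.smooth_anchor x).of_le le2)
        ((η.smooth_anchor x).of_le le2)

theorem lie_op (δ ε : GaugeSec B F E) (u : Sec B F E) :
    ⁅δ, ε⁆.op u = δ.op (ε.op u) - ε.op (δ.op u) := rfl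

instance : LieAlgebra ℝ (GaugeSec B F E) where
  lie_smul c δ ε := by
    refine ext_op_symbol (fun u => ?_) ?_
    · simp only [lie_op, smul_op, op_smul, smul_sub]
    · ext x
      exact VectorField.mlieBracket_const_smul_right (ε.mdifferentiableAt_symbol x)

/-- The tautological representation of the derivations on the sections. -/
instance : LieRingModule (GaugeSec B F E) (Sec B F E) where
  bracket δ u := δ.op u
  add_lie _ _ _ := rfl
  lie_add δ := δ.op_add
  leibniz_lie δ ε u := by
    change δ.op (ε.op u) = (gaugeBracket δ ε).op u + ε.op (δ.op u)
    rw [op_gaugeBracket]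
    abel

instance : LieModule ℝ (GaugeSec B F E) (Sec B F E) where
  smul_lie _ _ _ := rfl
  lie_smul c δ u := δ.op_smul c u

theorem lie_sec (δ : GaugeSec B F E) (u : Sec B F E) : ⁅δ, u⁆ = δ.op u := rfl

theorem lie_eq (δ ε : GaugeSec B F E) : ⁅δ, ε⁆ = gaugeBracket δ ε := rfl

end GaugeSec

/-- A form on the gauge algebroid as a cochain of the Lie algebra of derivations. -/
def GaugeForm.toCochain {k : ℕ} (μ : GaugeForm B F E k) :
    GaugeSec B F E [⋀^Fin k]→ₗ[ℝ] Sec B F E where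
  toFun := μ.eval
  map_update_add' δ i a b := by
    ext x
    exact ((μ.toFun x).compLinearMap (GaugeSec.evalAt x)).map_update_add δ i a b
  map_update_smul' δ i c a := by
    ext x
    exact ((μ.toFun x).compLinearMap (GaugeSec.evalAt x)).map_update_smul δ i c a
  map_eq_zero_of_eq' δ i j h hij := by
    ext x
    exact (μ.toFun x).map_eq_zero_of_eq _ (by simp [h]) hij

theorem GaugeForm.toCochain_apply {k : ℕ} (μ : GaugeForm B F E k) (δ : Fin k → GaugeSec B F E) :
    μ.toCochain δ = μ.eval δ := rfl

theorem GaugeForm.eval_vecCons {k : ℕ} (μ : GaugeForm B F E (k + 1)) (δ : GaugeSec B F E)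
    (ε : Fin k → GaugeSec B F E) (x : M) :
    μ.eval (Matrix.vecCons δ ε) x =
      μ.toFun x (Matrix.vecCons (δ.toFun x) (fun i => (ε i).toFun x)) := by
  refine congrArg (μ.toFun x) (funext fun i => ?_)
  refine Fin.cases ?_ (fun i => ?_) i <;> rfl

/-- The contraction of a vector bundle form with a derivation. -/
def JetForm.contractWith {k : ℕ} (μ : JetForm B F E (k + 1)) (δ : GaugeSec B F E) :
    JetForm B F E k where
  toFun x := (μ.toFun x).curryLeft (δ.toFun x)
  smooth ε := by
    refine (μ.eval (Matrix.vecCons δ ε)).contMDiff.congr fun x => ?_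
    exact congrArg _ (μ.eval_vecCons δ ε x).symm
  mem x := curryLeft_mem_jetFiber (μ.mem x) _

theorem JetForm.contractWith_eval {k : ℕ} (μ : JetForm B F E (k + 1)) (δ : GaugeSec B F E)
    (ε : Fin k → GaugeSec B F E) :
    (μ.contractWith δ).eval ε = μ.eval (Matrix.vecCons δ ε) := by
  ext x
  exact (μ.eval_vecCons δ ε x).symm

theorem JetForm.contractWith_toCochain {k : ℕ} (μ : JetForm B F E (k + 1))
    (δ : GaugeSec B F E) :
    (μ.contractWith δ).toCochain = μ.toCochain.curryLeft δ := by
  ext1 ε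
  exact μ.contractWith_eval δ ε

section Calculus

variable [FiniteDimensional ℝ B]

/-- The de Rham differential is the Chevalley–Eilenberg differential of the Lie algebra of
derivations with coefficients in the sections of `E`. -/
theorem deRham_eq_differential : ∀ {k : ℕ} (μ : GaugeForm B F E k)
    (δ : Fin (k + 1) → GaugeSec B F E), deRham μ δ = LieCochain.differential k μ.toCochain δ
  | 0, μ, δ => by
    rw [LieCochain.differential_zero_apply, GaugeForm.toCochain_apply, deRham,
      Subsingleton.elim ![] (Fin.elim0 : Fin 0 → GaugeSec B F E)]
    rfl
  | k + 1, μ, δ => by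
    rw [LieCochain.differential_apply, deRham]
    rfl

theorem lieDeriv_eq_lieDeriv {k : ℕ} (δ : GaugeSec B F E) (μ : GaugeForm B F E k)
    (ε : Fin k → GaugeSec B F E) : lieDeriv δ μ ε = LieCochain.lieDeriv δ μ.toCochain ε := by
  rw [LieCochain.lieDeriv_apply, lieDeriv]
  rfl

end Calculus

variable (B F E) in
/-- The identity of `E` as a derivation with symbol zero. -/
def idSec : GaugeSec B F E where
  toFun _ := ofEnd LinearMap.id
  smooth_act u := u.contMDiff
  smooth_anchor := (0 : VField B M).contMDiff

theorem idSec_op (u : Sec B F E) : (idSec B F E).op u = u := rfl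

theorem symbol_lie_eq_zero [FiniteDimensional ℝ B] {δ : GaugeSec B F E} (h : δ.symbol = 0)
    (ε : GaugeSec B F E) : ⁅δ, ε⁆.symbol = 0 := by
  ext x
  rw [GaugeSec.lie_eq, GaugeSec.symbol_gaugeBracket, h]
  have := VectorField.mlieBracket_zero_left (I := 𝓘(ℝ, B)) (W := fun x => ε.symbol x)
  exact congrFun this x

theorem idSec_lie [FiniteDimensional ℝ B] (ε : GaugeSec B F E) : ⁅idSec B F E, ε⁆ = 0 := by
  refine GaugeSec.ext_op_symbol (fun u => ?_) (symbol_lie_eq_zero rfl ε)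
  rw [GaugeSec.lie_op, idSec_op, idSec_op, sub_self]
  rfl

/-! ### Frames of the gauge algebroid -/

variable (B F E) in
/-- A local frame of `E` near `x₀` and its dual frame, both cut off to global objects: the
coefficients of a section, multiplied with the frame, give back the section up to a `weight` which
is `1` near `x₀`. -/
structure BundleFrame (x₀ : M) where
  rank : ℕ
  sec : Fin rank → Sec B F E
  coeff : Fin rank → ∀ x, E x →ₗ[ℝ] ℝ
  weight : C^∞⟮𝓘(ℝ, B), M; ℝ⟯
  smooth_coeff : ∀ i (u : Sec B F E), ContMDiff 𝓘(ℝ, B) 𝓘(ℝ, ℝ) ∞ (fun x => coeff i x (u x))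
  sum_coeff : ∀ x (v : E x), ∑ i, coeff i x v • sec i x = weight x • v
  weight_eq_one : ∀ᶠ x in nhds x₀, weight x = 1
  coeff_sec : ∀ᶠ x in nhds x₀, ∀ i j, coeff i x (sec j x) = if i = j then 1 else 0

theorem exists_contMDiff_cutoff [FiniteDimensional ℝ B] [T2Space M] {x₀ : M} {s : Set M}
    (hs : s ∈ nhds x₀) : ∃ ψ : C^∞⟮𝓘(ℝ, B), M; ℝ⟯, tsupport ψ ⊆ s ∧ ∀ᶠ x in nhds x₀, ψ x = 1 := by
  obtain ⟨f, hf, -⟩ := (SmoothBumpFunction.nhds_basis_support (I := 𝓘(ℝ, B)) hs).mem_iff.1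
    Filter.univ_mem
  exact ⟨⟨f, f.contMDiff⟩, hf, f.eventuallyEq_one⟩

theorem nonempty_bundleFrame [FiniteDimensional ℝ B] [T2Space M] [FiniteDimensional ℝ F]
    [ContMDiffVectorBundle ∞ F E 𝓘(ℝ, B)] (x₀ : M) : Nonempty (BundleFrame B F E x₀) := by
  have : ContMDiffVectorBundle 1 F E 𝓘(ℝ, B) := ContMDiffVectorBundle.of_le (n := ∞) (by simp)
  set e := trivializationAt F E x₀ with he
  have hx₀ : x₀ ∈ e.baseSet := FiberBundle.mem_baseSet_trivializationAt' x₀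
  have hmem : e.baseSet ∈ nhds x₀ := e.open_baseSet.mem_nhds hx₀
  obtain ⟨ψ, hψ, hψ1⟩ := exists_contMDiff_cutoff (B := B) hmem
  set b := Module.finBasis ℝ F
  have hzero : ∀ x, x ∉ e.baseSet → ψ x = 0 := fun x hx =>
    image_eq_zero_of_notMem_tsupport (fun h => hx (hψ h))
  have hc : ∀ x (hx : x ∈ e.baseSet) (v : E x) i,
      e.localFrameCoeff 𝓘(ℝ, B) b i x v = (e.basisAt b hx).repr v i := by
    intro x hx v i
    classical
    -- The coefficient is defined on sections: extend `v` by zero.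
    have := e.localFrameCoeff_apply_of_mem_baseSet (I := 𝓘(ℝ, B)) b hx
      (Function.update (fun _ => 0) x v) i
    simpa using this
  -- Both the frame and its dual are multiplied with `ψ`, so that the weight is `ψ ^ 2`.
  have hmul : ∀ x, (ψ * ψ) x = ψ x * ψ x := fun _ => rfl
  refine ⟨⟨Module.finrank ℝ F, fun i => ⟨fun x => ψ x • e.localFrame b i x, ?_⟩,
    fun i x => ψ x • e.localFrameCoeff 𝓘(ℝ, B) b i x, ψ * ψ, fun i u => ?_, fun x v => ?_, ?_, ?_⟩⟩
  · exact ContMDiffOn.smul_section_of_tsupport ψ.contMDiff.contMDiffOn e.open_baseSet hψ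
      (e.contMDiffOn_localFrame_baseSet ∞ b i)
  · have hon : ContMDiffOn 𝓘(ℝ, B) 𝓘(ℝ, ℝ) ∞
        ((LinearMap.piApply (e.localFrameCoeff 𝓘(ℝ, B) b i)) u) e.baseSet :=
      contMDiffOn_baseSet_localFrameCoeff b u.contMDiff.contMDiffOn i
    refine contMDiff_of_tsupport fun x hx => ?_
    have hx' : x ∈ e.baseSet := hψ (tsupport_smul_subset_left ψ _ hx)
    exact ψ.contMDiff.contMDiffAt.smul (hon.contMDiffAt (e.open_baseSet.mem_nhds hx'))
  · by_cases hx : x ∈ e.baseSet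
    · have hb := (e.basisAt b hx).sum_repr v
      simp only [LinearMap.smul_apply, hc x hx, ContMDiffSection.coeFn_mk,
        e.localFrame_apply_of_mem_baseSet b hx, hmul, smul_eq_mul]
      conv_rhs => rw [← hb, Finset.smul_sum]
      refine Finset.sum_congr rfl fun i _ => ?_
      module
    · simp [hzero x hx]
  · filter_upwards [hψ1] with x hx
    simp [hx, hmul]
  · filter_upwards [hψ1, hmem] with x hx hx' i j
    simp only [ContMDiffSection.coeFn_mk, hx, one_smul, hc x hx',
      e.localFrame_apply_of_mem_baseSet b hx', Module.Basis.repr_self]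
    simp [Finsupp.single_apply, eq_comm]

omit [IsManifold 𝓘(ℝ, B) ∞ M] in
theorem sum_sec_apply {ι : Type*} (s : Finset ι) (u : ι → Sec B F E) (x : M) :
    (∑ i ∈ s, u i) x = ∑ i ∈ s, u i x := by
  rw [← Finset.sum_apply]
  exact congrFun (map_sum (ContMDiffSection.coeAddHom 𝓘(ℝ, B) F ∞ E) u s) x

/-- The action of elements of `𝔇ₓE` on a section, as a linear map. -/
def actOn (x : M) (u : Sec B F E) : gaugeFiber B F E x →ₗ[ℝ] E x where
  toFun δ := act δ u
  map_add' _ _ := rfl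
  map_smul' _ _ := rfl

namespace BundleFrame

variable {x₀ : M} (φ : BundleFrame B F E x₀)

/-- The coefficients of a section with respect to a frame. -/
def coeffFun (i : Fin φ.rank) (u : Sec B F E) : C^∞⟮𝓘(ℝ, B), M; ℝ⟯ :=
  ⟨fun x => φ.coeff i x (u x), φ.smooth_coeff i u⟩

omit [IsManifold 𝓘(ℝ, B) ∞ M] in
theorem coeffFun_add (i : Fin φ.rank) (u v : Sec B F E) :
    φ.coeffFun i (u + v) = φ.coeffFun i u + φ.coeffFun i v := by
  ext x
  exact map_add (φ.coeff i x) (u x) (v x)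

omit [IsManifold 𝓘(ℝ, B) ∞ M] in
theorem coeffFun_smul (i : Fin φ.rank) (c : ℝ) (u : Sec B F E) :
    φ.coeffFun i (c • u) = c • φ.coeffFun i u := by
  ext x
  exact map_smul (φ.coeff i x) c (u x)

omit [IsManifold 𝓘(ℝ, B) ∞ M] in
theorem coeffFun_funSmul (i : Fin φ.rank) (f : C^∞⟮𝓘(ℝ, B), M; ℝ⟯) (u : Sec B F E) :
    φ.coeffFun i (funSmul f u) = f * φ.coeffFun i u := by
  ext x
  exact map_smul (φ.coeff i x) (f x) (u x)

omit [IsManifold 𝓘(ℝ, B) ∞ M] in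
theorem mdifferentiableAt (f : C^∞⟮𝓘(ℝ, B), M; ℝ⟯) (x : M) :
    MDifferentiableAt 𝓘(ℝ, B) 𝓘(ℝ, ℝ) f x :=
  f.contMDiff.mdifferentiableAt (by simp)

/-- The frame of `E` near `x₀` is flat for a connection near `x₀`. This is the covariant derivative
along `X`, cut off away from `x₀`: it differentiates the coefficients of a section. -/
def lift (X : VField B M) : GaugeSec B F E where
  toFun x := ⟨({ toFun := fun u => ∑ i, mvfderiv 𝓘(ℝ, B) (φ.coeffFun i u) x (X x) • φ.sec i x
                 map_add' := fun u v => by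
                   rw [← Finset.sum_add_distrib]
                   refine Finset.sum_congr rfl fun i _ => ?_
                   rw [coeffFun_add, ContMDiffMap.coe_add,
                     mvfderiv_add (mdifferentiableAt _ _) (mdifferentiableAt _ _)]
                   exact add_smul _ _ _
                 map_smul' := fun c u => by
                   rw [RingHom.id_apply, Finset.smul_sum]
                   refine Finset.sum_congr rfl fun i _ => ?_
                   rw [coeffFun_smul, smul_smul]
                   congr 1
                   have h := mvfderiv_smul (I := 𝓘(ℝ, B)) (x := x) (a := fun _ => c)
                     mdifferentiableAt_const (mdifferentiableAt (φ.coeffFun i u) x)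
                   rw [mvfderiv_const] at h
                   have h' : mvfderiv 𝓘(ℝ, B) (c • ⇑(φ.coeffFun i u)) x (X x) = _ :=
                     DFunLike.congr_fun h (X x)
                   rw [ContMDiffMap.coe_smul, h']
                   simp }, φ.weight x • X x), by
    intro f u
    have h : ∀ i, mvfderiv 𝓘(ℝ, B) (φ.coeffFun i (funSmul f u)) x (X x) =
        f x * mvfderiv 𝓘(ℝ, B) (φ.coeffFun i u) x (X x) +
          mvfderiv 𝓘(ℝ, B) f x (X x) * φ.coeff i x (u x) := by
      intro i
      rw [coeffFun_funSmul, ContMDiffMap.coe_mul,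
        mvfderiv_mul (mdifferentiableAt _ _) (mdifferentiableAt _ _)]
      simp [coeffFun, mul_comm]
    simp only [LinearMap.coe_mk, AddHom.coe_mk, h, add_smul, mul_smul, Finset.sum_add_distrib,
      ← Finset.smul_sum, φ.sum_coeff, map_smul, smul_eq_mul]
    module⟩
  smooth_act u := by
    have : ∀ i, ContMDiff 𝓘(ℝ, B) 𝓘(ℝ, ℝ) ∞
        (fun x => mvfderiv 𝓘(ℝ, B) (φ.coeffFun i u) x (X x)) := fun i =>
      contMDiff_mvfderiv_apply (φ.coeffFun i u).contMDiff X.contMDiff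
    exact ContMDiff.sum_section (s := Finset.univ)
      fun i _ => (this i).smul_section (φ.sec i).contMDiff
  smooth_anchor := φ.weight.contMDiff.smul_section X.contMDiff

theorem anchor_lift (X : VField B M) (x : M) :
    anchor x ((φ.lift X).toFun x) = φ.weight x • X x := rfl

theorem act_lift (X : VField B M) (x : M) (u : Sec B F E) : act ((φ.lift X).toFun x) u =
    ∑ i, mvfderiv 𝓘(ℝ, B) (φ.coeffFun i u) x (X x) • φ.sec i x := rfl

/-- The elementary endomorphisms with respect to a frame, as derivations. -/
def endSec (i j : Fin φ.rank) : GaugeSec B F E where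
  toFun x := ofEnd ((φ.coeff i x).smulRight (φ.sec j x))
  smooth_act u := (φ.smooth_coeff i u).smul_section (φ.sec j).contMDiff
  smooth_anchor := (0 : VField B M).contMDiff

theorem anchor_endSec (i j : Fin φ.rank) (x : M) : anchor x ((φ.endSec i j).toFun x) = 0 := rfl

omit [IsManifold 𝓘(ℝ, B) ∞ M] in
theorem mvfderiv_eq_zero_of_eventually_const {x : M} {f : M → ℝ} {c : ℝ}
    (h : ∀ᶠ y in nhds x, f y = c) : mvfderiv 𝓘(ℝ, B) f x = 0 := by
  unfold mvfderiv
  rw [Filter.EventuallyEq.mfderiv_eq (f := fun _ => c) h, mfderiv_const]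
  exact ContinuousLinearMap.comp_zero _

omit [IsManifold 𝓘(ℝ, B) ∞ M] in
/-- Near `x₀`, an element of `𝔇E` is determined by its symbol and its action on a frame. -/
theorem eventually_ext : ∀ᶠ x in nhds x₀, ∀ δ ε : gaugeFiber B F E x, anchor x δ = anchor x ε →
    (∀ i, act δ (φ.sec i) = act ε (φ.sec i)) → δ = ε := by
  filter_upwards [eventually_eventually_nhds.2 φ.weight_eq_one] with x hx
  intro δ ε h h'
  rw [← sub_eq_zero]
  set η := δ - ε with hη
  have ha : anchor x η = 0 := by rw [hη, map_sub, h, sub_self]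
  have hs : ∀ i, act η (φ.sec i) = 0 := fun i => by
    have := map_sub (actOn x (φ.sec i)) δ ε
    exact this.trans (sub_eq_zero.2 (h' i))
  have hL : ∀ f (u : Sec B F E), act η (funSmul f u) = f x • act η u := by
    intro f u
    have h1 := η.2 f u
    have h2 : η.1.2 = 0 := ha
    rw [h2, map_zero, zero_smul, zero_add] at h1
    exact h1
  refine Subtype.ext (Prod.ext ?_ ha)
  ext u
  have hu : funSmul φ.weight u = ∑ i, funSmul (φ.coeffFun i u) (φ.sec i) := by
    ext y
    rw [sum_sec_apply]
    exact (φ.sum_coeff y (u y)).symm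
  have h1 : act η u = act η (funSmul φ.weight u) := by
    rw [hL, hx.self_of_nhds, one_smul]
  change act η u = 0
  rw [h1, hu]
  refine (map_sum η.1.1 _ _).trans (Finset.sum_eq_zero fun i _ => ?_)
  refine (hL _ _).trans ?_
  rw [hs, smul_zero]

theorem sum_coeff_endSec_act {x : M} (i : Fin φ.rank) (c : Fin φ.rank × Fin φ.rank → ℝ)
    (hx : ∀ i j, φ.coeff i x (φ.sec j x) = if i = j then 1 else 0) :
    act (∑ p, c p • (φ.endSec p.1 p.2).toFun x) (φ.sec i) = ∑ j, c (i, j) • φ.sec j x := by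
  refine (map_sum (actOn x (φ.sec i)) _ _).trans ?_
  have h : ∀ p : Fin φ.rank × Fin φ.rank, actOn x (φ.sec i) (c p • (φ.endSec p.1 p.2).toFun x) =
      c p • (φ.coeff p.1 x (φ.sec i x) • φ.sec p.2 x) := fun p => map_smul (actOn x _) _ _
  simp only [h, hx, Fintype.sum_prod_type, ite_smul, one_smul, zero_smul, smul_ite, smul_zero]
  rw [Finset.sum_comm]
  simp

/-- Every endomorphism of the fibre `E x₀` extends to a derivation with symbol zero. -/
theorem exists_gaugeSec_ofEnd {x₀ : M} (φ : BundleFrame B F E x₀) (Φ : E x₀ →ₗ[ℝ] E x₀) :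
    ∃ δ : GaugeSec B F E, δ.symbol = 0 ∧ δ.toFun x₀ = ofEnd Φ := by
  set δ : GaugeSec B F E :=
    ∑ p : Fin φ.rank × Fin φ.rank, φ.coeff p.2 x₀ (Φ (φ.sec p.1 x₀)) • φ.endSec p.1 p.2 with hδ
  have hval : ∀ x, δ.toFun x = ∑ p : Fin φ.rank × Fin φ.rank,
      φ.coeff p.2 x₀ (Φ (φ.sec p.1 x₀)) • (φ.endSec p.1 p.2).toFun x := fun x =>
    map_sum (GaugeSec.evalAt x) _ _
  have hanchor : ∀ x, anchor x (δ.toFun x) = 0 := by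
    intro x
    rw [hval, map_sum]
    refine Finset.sum_eq_zero fun p _ => ?_
    rw [map_smul, anchor_endSec, smul_zero]
  refine ⟨δ, ?_, ?_⟩
  · ext x
    exact hanchor x
  · refine φ.eventually_ext.self_of_nhds _ _ (hanchor x₀) fun i => ?_
    rw [hval, φ.sum_coeff_endSec_act i _ φ.coeff_sec.self_of_nhds]
    refine (φ.sum_coeff x₀ (Φ (φ.sec i x₀))).trans ?_
    rw [φ.weight_eq_one.self_of_nhds, one_smul]
    rfl

end BundleFrame

variable (B F E) in
/-- A local frame of `𝔇E` near `x₀` together with its dual frame, cut off to global objects. -/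
structure GaugeFrame (x₀ : M) where
  rank : ℕ
  sec : Fin rank → GaugeSec B F E
  coeff : Fin rank → ∀ x, gaugeFiber B F E x →ₗ[ℝ] ℝ
  smooth_coeff : ∀ i (δ : GaugeSec B F E),
    ContMDiff 𝓘(ℝ, B) 𝓘(ℝ, ℝ) ∞ (fun x => coeff i x (δ.toFun x))
  sum_coeff : ∀ᶠ x in nhds x₀, ∀ δ : gaugeFiber B F E x, ∑ i, coeff i x δ • (sec i).toFun x = δ
  coeff_sec : ∀ᶠ x in nhds x₀, ∀ i j, coeff i x ((sec j).toFun x) = if i = j then 1 else 0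

/-- A frame of `𝔇E` consists of the elementary endomorphisms with respect to a frame of `E` and of
lifts of a frame of `TM`. The dual frame reads off the symbol and the action on the frame of
`E`. -/
theorem nonempty_gaugeFrame [FiniteDimensional ℝ B] [T2Space M] [FiniteDimensional ℝ F]
    [ContMDiffVectorBundle ∞ F E 𝓘(ℝ, B)] (x₀ : M) : Nonempty (GaugeFrame B F E x₀) := by
  have : IsManifold 𝓘(ℝ, B) (((⊤ : ℕ∞) : WithTop ℕ∞) + 1) M := by simpa
  obtain ⟨φ⟩ := nonempty_bundleFrame (B := B) (F := F) (E := E) x₀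
  obtain ⟨τ⟩ := nonempty_bundleFrame (B := B) (F := B) (E := (TangentSpace 𝓘(ℝ, B) : M → Type _)) x₀
  let ι := Fin τ.rank ⊕ Fin φ.rank × Fin φ.rank
  let sec : ι → GaugeSec B F E :=
    Sum.elim (fun k => φ.lift (τ.sec k)) (fun p => φ.endSec p.1 p.2)
  let coeff : ι → ∀ x, gaugeFiber B F E x →ₗ[ℝ] ℝ :=
    Sum.elim (fun k x => τ.coeff k x ∘ₗ anchor x)
      (fun p x => φ.coeff p.2 x ∘ₗ actOn x (φ.sec p.1))
  have hsmooth : ∀ i (δ : GaugeSec B F E),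
      ContMDiff 𝓘(ℝ, B) 𝓘(ℝ, ℝ) ∞ (fun x => coeff i x (δ.toFun x)) := by
    rintro (k | p) δ
    · exact τ.smooth_coeff k δ.symbol
    · exact φ.smooth_coeff p.2 (δ.op (φ.sec p.1))
  -- The frame of `E` is flat with respect to the lifts, as its coefficients are locally constant.
  have hflat : ∀ᶠ x in nhds x₀, ∀ X i, act ((φ.lift X).toFun x) (φ.sec i) = 0 := by
    filter_upwards [eventually_eventually_nhds.2 φ.coeff_sec] with x hx X i
    rw [φ.act_lift]
    refine Finset.sum_eq_zero fun j _ => ?_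
    rw [BundleFrame.mvfderiv_eq_zero_of_eventually_const (f := φ.coeffFun j (φ.sec i))
      (c := if j = i then 1 else 0) (hx.mono fun y hy => hy j i)]
    simp
  have hsum : ∀ᶠ x in nhds x₀, ∀ δ : gaugeFiber B F E x,
      ∑ i, coeff i x δ • (sec i).toFun x = δ := by
    filter_upwards [φ.eventually_ext, φ.coeff_sec, φ.weight_eq_one, τ.weight_eq_one, hflat]
      with x hext hφ hw hw' hfl δ
    rw [Fintype.sum_sum_type]
    refine hext _ _ ?_ fun i => ?_
    · rw [map_add, map_sum, map_sum]
      have h1 : ∀ k, anchor x (coeff (Sum.inl k) x δ • (sec (Sum.inl k)).toFun x) =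
          τ.coeff k x (anchor x δ) • τ.sec k x := fun k => by
        rw [map_smul]
        change _ • anchor x ((φ.lift (τ.sec k)).toFun x) = _
        rw [φ.anchor_lift, hw, one_smul]
        rfl
      have h2 : ∀ p, anchor x (coeff (Sum.inr p) x δ • (sec (Sum.inr p)).toFun x) = 0 :=
        fun p => by
          rw [map_smul]
          exact smul_zero _
      simp only [h1, h2, Finset.sum_const_zero, add_zero]
      exact (τ.sum_coeff x (anchor x δ)).trans (by rw [hw', one_smul])
    · refine (map_add (actOn x (φ.sec i)) _ _).trans ?_
      have h1 : actOn x (φ.sec i) (∑ k, coeff (Sum.inl k) x δ • (sec (Sum.inl k)).toFun x) = 0 := by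
        rw [map_sum]
        refine Finset.sum_eq_zero fun k _ => ?_
        rw [map_smul]
        exact (congrArg _ (hfl (τ.sec k) i)).trans (smul_zero _)
      rw [h1, zero_add]
      refine (φ.sum_coeff_endSec_act i (fun p => coeff (Sum.inr p) x δ) hφ).trans ?_
      exact (φ.sum_coeff x (act δ (φ.sec i))).trans (by rw [hw, one_smul])
  have hdual : ∀ᶠ x in nhds x₀, ∀ i j,
      coeff i x ((sec j).toFun x) = if i = j then 1 else 0 := by
    filter_upwards [φ.coeff_sec, τ.coeff_sec, φ.weight_eq_one, hflat] with x hφ hτ hw hfl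
    rintro (k | p) (l | q)
    · change τ.coeff k x (φ.weight x • τ.sec l x) = _
      rw [hw, one_smul, hτ]
      exact if_congr Sum.inl_injective.eq_iff.symm rfl rfl
    · change τ.coeff k x 0 = _
      rw [map_zero, if_neg Sum.inl_ne_inr]
    · change φ.coeff p.2 x (act ((φ.lift (τ.sec l)).toFun x) (φ.sec p.1)) = _
      rw [hfl, map_zero, if_neg Sum.inr_ne_inl]
    · change φ.coeff p.2 x (φ.coeff q.1 x (φ.sec p.1 x) • φ.sec q.2 x) = _
      rw [map_smul, hφ, hφ, smul_eq_mul, ite_zero_mul_ite_zero, one_mul]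
      refine if_congr ?_ rfl rfl
      rw [Sum.inr_injective.eq_iff, Prod.ext_iff, eq_comm (a := q.1)]
  let e := Fintype.equivFin ι
  refine ⟨⟨Fintype.card ι, fun i => sec (e.symm i), fun i => coeff (e.symm i),
    fun i => hsmooth _, ?_, ?_⟩⟩
  · filter_upwards [hsum] with x hx δ
    exact (e.symm.sum_comp fun i => coeff i x δ • (sec i).toFun x).trans (hx δ)
  · filter_upwards [hdual] with x hx i j
    rw [hx]
    simp

/-! ### Tensorial cochains are forms -/

/-- A cochain is tensorial if it is linear over the smooth functions in each argument. -/
def IsTensorial {k : ℕ} (α : GaugeSec B F E [⋀^Fin k]→ₗ[ℝ] Sec B F E) : Prop :=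
  ∀ (δ : Fin k → GaugeSec B F E) (i : Fin k) (f : C^∞⟮𝓘(ℝ, B), M; ℝ⟯) (ε : GaugeSec B F E),
    α (Function.update δ i (ε.fmul f)) = funSmul f (α (Function.update δ i ε))

theorem GaugeForm.isTensorial {k : ℕ} (μ : GaugeForm B F E k) : IsTensorial μ.toCochain := by
  intro δ i f ε
  have h : ∀ (ε : GaugeSec B F E) x, (fun j => (Function.update δ i ε j).toFun x) =
      Function.update (fun j => (δ j).toFun x) i (ε.toFun x) := by
    intro ε x
    funext j
    by_cases hj : j = i
    · subst hj; simp
    · simp [hj]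
  ext x
  change μ.toFun x _ = f x • μ.toFun x _
  rw [h, h]
  exact (μ.toFun x).map_update_smul _ i (f x) (ε.toFun x)

omit [IsManifold 𝓘(ℝ, B) ∞ M] in
theorem funSmul_neg (f : C^∞⟮𝓘(ℝ, B), M; ℝ⟯) (u : Sec B F E) :
    funSmul f (-u) = -funSmul f u := by
  ext x
  exact smul_neg (f x) (u x)

omit [IsManifold 𝓘(ℝ, B) ∞ M] in
theorem funSmul_sub (f : C^∞⟮𝓘(ℝ, B), M; ℝ⟯) (u v : Sec B F E) :
    funSmul f (u - v) = funSmul f u - funSmul f v := by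
  ext x
  exact smul_sub (f x) (u x) (v x)

omit [IsManifold 𝓘(ℝ, B) ∞ M] in
theorem funSmul_sum {ι : Type*} (s : Finset ι) (f : C^∞⟮𝓘(ℝ, B), M; ℝ⟯) (u : ι → Sec B F E) :
    funSmul f (∑ i ∈ s, u i) = ∑ i ∈ s, funSmul f (u i) := by
  ext x
  rw [sum_sec_apply]
  change f x • (∑ i ∈ s, u i) x = _
  rw [sum_sec_apply, Finset.smul_sum]
  rfl

theorem IsTensorial.curryLeft {k : ℕ} {α : GaugeSec B F E [⋀^Fin (k + 1)]→ₗ[ℝ] Sec B F E}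
    (h : IsTensorial α) (δ : GaugeSec B F E) : IsTensorial (α.curryLeft δ) := by
  intro ζ i f ε
  have hc : ∀ ε, Matrix.vecCons δ (Function.update ζ i ε) =
      Function.update (Matrix.vecCons δ ζ) i.succ ε := fun ε =>
    Fin.cons_update (α := fun _ => GaugeSec B F E) δ ζ i ε
  simp only [AlternatingMap.curryLeft_apply_apply, hc, h (Matrix.vecCons δ ζ) i.succ f ε]

/-- By antisymmetry, it suffices to check tensoriality in all arguments but the first one. -/
theorem IsTensorial.of_curryLeft {k : ℕ} {α : GaugeSec B F E [⋀^Fin (k + 2)]→ₗ[ℝ] Sec B F E}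
    (h : ∀ δ, IsTensorial (α.curryLeft δ)) : IsTensorial α := by
  intro ζ i f ε
  obtain ⟨a, η, rfl⟩ : ∃ a η, ζ = Matrix.vecCons a η := ⟨_, _, (Matrix.cons_head_tail ζ).symm⟩
  rcases Fin.eq_zero_or_eq_succ i with rfl | ⟨i, rfl⟩
  · obtain ⟨b, θ, rfl⟩ : ∃ b θ, η = Matrix.vecCons b θ := ⟨_, _, (Matrix.cons_head_tail η).symm⟩
    have hc : ∀ ε, α (Function.update (Matrix.vecCons a (Matrix.vecCons b θ)) 0 ε) =
        -α.curryLeft b (Function.update (Matrix.vecCons a θ) 0 ε) := by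
      intro ε
      have h1 : Function.update (Matrix.vecCons a (Matrix.vecCons b θ)) 0 ε =
          Matrix.vecCons ε (Matrix.vecCons b θ) :=
        Fin.update_cons_zero (α := fun _ => GaugeSec B F E) _ _ _
      have h2 : Function.update (Matrix.vecCons a θ) 0 ε = Matrix.vecCons ε θ :=
        Fin.update_cons_zero (α := fun _ => GaugeSec B F E) _ _ _
      rw [h1, h2, AlternatingMap.curryLeft_apply_apply, AlternatingMap.map_vecCons_swap]
    rw [hc, hc, h b, funSmul_neg]
  · have hc : ∀ ε, α (Function.update (Matrix.vecCons a η) i.succ ε) =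
        α.curryLeft a (Function.update η i ε) := by
      intro ε
      rw [AlternatingMap.curryLeft_apply_apply]
      exact congrArg α (Fin.cons_update (α := fun _ => GaugeSec B F E) a η i ε).symm
    rw [hc, hc, h a]

section Calculus

variable [FiniteDimensional ℝ B]

theorem GaugeSec.lie_fmul (δ ε : GaugeSec B F E) (f : C^∞⟮𝓘(ℝ, B), M; ℝ⟯) :
    ⁅δ, ε.fmul f⁆ = ε.fmul (δ.deriv f) + ⁅δ, ε⁆.fmul f := by
  refine GaugeSec.ext_op_symbol (fun u => ?_) ?_
  · have h1 : ∀ (η : GaugeSec B F E) (g : C^∞⟮𝓘(ℝ, B), M; ℝ⟯),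
        (η.fmul g).op u = funSmul g (η.op u) := fun _ _ => rfl
    have h2 : (ε.fmul f).op (δ.op u) = funSmul f (ε.op (δ.op u)) := rfl
    rw [lie_op, add_op, h1, h1, h1, h2, op_funSmul, lie_op, funSmul_sub, add_sub_assoc]
  · ext x
    exact VectorField.mlieBracket_smul_right (f.contMDiff.mdifferentiableAt (by simp))
      (ε.mdifferentiableAt_symbol x)

theorem IsTensorial.lieDeriv {k : ℕ} {α : GaugeSec B F E [⋀^Fin k]→ₗ[ℝ] Sec B F E}
    (h : IsTensorial α) (δ : GaugeSec B F E) : IsTensorial (LieCochain.lieDeriv δ α) := by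
  intro ζ i f ε
  set ξ := Function.update ζ i ε with hξ
  have hξi : ξ i = ε := by simp [hξ]
  have hup : ∀ η, Function.update ζ i η = Function.update ξ i η := by
    intro η; simp [hξ]
  rw [hup, LieCochain.lieDeriv_apply, LieCochain.lieDeriv_apply, h, ← hup]
  -- The terms with the derivative of `f`, from `⁅δ, f ε⁆` and from `⁅δ, f α⁆`, cancel.
  have key : ∀ j, α (Function.update (Function.update ξ i (ε.fmul f)) j
        ⁅δ, Function.update ξ i (ε.fmul f) j⁆) =
      funSmul f (α (Function.update ξ j ⁅δ, ξ j⁆)) +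
        if j = i then funSmul (δ.deriv f) (α ξ) else 0 := by
    intro j
    by_cases hj : j = i
    · subst hj
      rw [Function.update_self, Function.update_idem, GaugeSec.lie_fmul, α.map_update_add, h, h,
        if_pos rfl, add_comm, hξi]
      congr 2
      rw [← hξi, Function.update_eq_self]
    · rw [Function.update_of_ne hj, Function.update_comm (Ne.symm hj), h, if_neg hj, add_zero,
        Function.update_comm hj, ← hξi, Function.update_eq_self]
  rw [Finset.sum_congr rfl fun j _ => key j, Finset.sum_add_distrib]
  simp only [Finset.sum_ite_eq', Finset.mem_univ, if_true]
  rw [GaugeSec.lie_sec, GaugeSec.lie_sec, GaugeSec.op_funSmul]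
  rw [funSmul_sub, funSmul_sum, ← hξ]
  abel

theorem IsTensorial.differential : ∀ {k : ℕ} {α : GaugeSec B F E [⋀^Fin k]→ₗ[ℝ] Sec B F E}
    (_ : IsTensorial α), IsTensorial (LieCochain.differential k α)
  | 0, α, _ => by
    intro ζ i f ε
    obtain rfl : i = 0 := Fin.fin_one_eq_zero i
    rw [LieCochain.differential_zero_apply,
      LieCochain.differential_zero_apply, Function.update_self, Function.update_self]
    rfl
  | k + 1, α, h => by
    refine IsTensorial.of_curryLeft fun δ => ?_
    intro ζ i f ε
    rw [LieCochain.curryLeft_differential]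
    simp only [AlternatingMap.sub_apply]
    rw [h.lieDeriv δ ζ i f ε, (h.curryLeft δ).differential ζ i f ε, funSmul_sub]

end Calculus

section Extension

variable [FiniteDimensional ℝ B] [T2Space M] [FiniteDimensional ℝ F]
    [ContMDiffVectorBundle ∞ F E 𝓘(ℝ, B)]

theorem evalAt_surjective (x : M) :
    Function.Surjective (GaugeSec.evalAt x : GaugeSec B F E →ₗ[ℝ] gaugeFiber B F E x) := by
  intro δ
  obtain ⟨φ⟩ := nonempty_gaugeFrame (B := B) (F := F) (E := E) x
  refine ⟨∑ i, φ.coeff i x δ • φ.sec i, ?_⟩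
  rw [map_sum]
  exact φ.sum_coeff.self_of_nhds δ

theorem exists_gaugeSec_eq (x : M) {k : ℕ} (δ : Fin k → gaugeFiber B F E x) :
    ∃ D : Fin k → GaugeSec B F E, ∀ i, (D i).toFun x = δ i :=
  ⟨fun i => (evalAt_surjective x (δ i)).choose, fun i => (evalAt_surjective x (δ i)).choose_spec⟩

theorem GaugeForm.ext_eval {k : ℕ} {μ ν : GaugeForm B F E k}
    (h : ∀ δ, μ.eval δ = ν.eval δ) : μ = ν := by
  ext x δ
  obtain ⟨D, hD⟩ := exists_gaugeSec_eq x δ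
  have := DFunLike.congr_fun (h D) x
  change μ.toFun x (fun i => (D i).toFun x) = ν.toFun x (fun i => (D i).toFun x) at this
  simpa only [hD] using this

/-- A tensorial cochain vanishes at a point at which one of its arguments vanishes. -/
theorem IsTensorial.apply_eq_zero {k : ℕ} {α : GaugeSec B F E [⋀^Fin k]→ₗ[ℝ] Sec B F E}
    (h : IsTensorial α) {δ : Fin k → GaugeSec B F E} {i : Fin k} {x : M}
    (hδ : (δ i).toFun x = 0) : α δ x = 0 := by
  obtain ⟨φ⟩ := nonempty_gaugeFrame (B := B) (F := F) (E := E) x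
  obtain ⟨χ, hχ, hχ1⟩ := exists_contMDiff_cutoff (B := B) φ.sum_coeff
  -- Near `x`, the argument is a combination of the frame with coefficients vanishing at `x`.
  set c : Fin φ.rank → C^∞⟮𝓘(ℝ, B), M; ℝ⟯ := fun j =>
    χ * ⟨fun y => φ.coeff j y ((δ i).toFun y), φ.smooth_coeff j (δ i)⟩ with hc
  have hsum : (δ i).fmul χ = ∑ j, (φ.sec j).fmul (c j) := by
    ext1
    funext y
    refine Eq.trans ?_ (map_sum (GaugeSec.evalAt y) (fun j => (φ.sec j).fmul (c j)) _).symm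
    change χ y • (δ i).toFun y =
      ∑ j, (χ y * φ.coeff j y ((δ i).toFun y)) • (φ.sec j).toFun y
    by_cases hy : y ∈ tsupport χ
    · simp only [mul_smul, ← Finset.smul_sum]
      rw [hχ hy]
    · simp [image_eq_zero_of_notMem_tsupport hy]
  have h1 := h δ i χ (δ i)
  rw [Function.update_eq_self, hsum, α.map_update_sum] at h1
  have h2 := DFunLike.congr_fun h1 x
  rw [sum_sec_apply] at h2
  have h3 : funSmul χ (α δ) x = α δ x := by
    change χ x • α δ x = _
    rw [hχ1.self_of_nhds, one_smul]
  rw [← h3, ← h2]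
  refine Finset.sum_eq_zero fun j _ => ?_
  rw [h]
  change (χ x * φ.coeff j x ((δ i).toFun x)) •
    (α (Function.update δ i (φ.sec j)) x : E x) = 0
  rw [hδ, map_zero, mul_zero, zero_smul]

/-- A tensorial cochain is given by a form on the gauge algebroid. -/
theorem IsTensorial.exists_gaugeForm {k : ℕ} {α : GaugeSec B F E [⋀^Fin k]→ₗ[ℝ] Sec B F E}
    (h : IsTensorial α) : ∃ μ : GaugeForm B F E k, ∀ δ, μ.eval δ = α δ := by
  have hs : ∀ x, ∃ s : gaugeFiber B F E x →ₗ[ℝ] GaugeSec B F E,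
      GaugeSec.evalAt x ∘ₗ s = LinearMap.id := fun x =>
    LinearMap.exists_rightInverse_of_surjective _ (LinearMap.range_eq_top.2 (evalAt_surjective x))
  choose s hs using hs
  -- The value at `x` is computed on arbitrary extensions `s x` of elements of `𝔇ₓE`.
  let ev : ∀ x, Sec B F E →ₗ[ℝ] E x := fun x =>
    { toFun := fun u => u x
      map_add' := fun _ _ => rfl
      map_smul' := fun _ _ => rfl }
  have key : ∀ x (δ : Fin k → GaugeSec B F E),
      ((ev x).compAlternatingMap α).compLinearMap (s x) (fun i => (δ i).toFun x) = α δ x := by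
    intro x δ
    refine AlternatingMap.map_congr_of_ker (GaugeSec.evalAt x) ((ev x).compAlternatingMap α)
      (fun v i hv => h.apply_eq_zero hv) (fun i => ?_)
    exact DFunLike.congr_fun (hs x) ((δ i).toFun x)
  refine ⟨⟨fun x => ((ev x).compAlternatingMap α).compLinearMap (s x), fun δ => ?_⟩, fun δ => ?_⟩
  · refine (α δ).contMDiff.congr fun x => ?_
    rw [key]
  · ext x
    exact key x δ

end Extension

/-! ### Graphs of vector bundle forms and isotropic subbundles -/

theorem coe_contract {k : ℕ} {x : M} (μ : jetFiber (B := B) (F := F) (E := E) (k + 1) x)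
    (δ : gaugeFiber B F E x) : (contract μ δ : gaugeFiber B F E x [⋀^Fin k]→ₗ[ℝ] E x) =
      μ.1.curryLeft δ := rfl

theorem contract_injective {k : ℕ} {x : M} {μ ν : jetFiber (B := B) (F := F) (E := E) (k + 1) x}
    (h : ∀ δ, contract μ δ = contract ν δ) : μ = ν :=
  Subtype.ext (AlternatingMap.ext_curryLeft fun δ => congrArg Subtype.val (h δ))

theorem contract_add {k : ℕ} {x : M} (μ ν : jetFiber (B := B) (F := F) (E := E) (k + 1) x)
    (δ : gaugeFiber B F E x) : contract (μ + ν) δ = contract μ δ + contract ν δ := rfl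

theorem JetForm.ext_at {k : ℕ} {μ ν : JetForm B F E k} (h : ∀ x, μ.at x = ν.at x) : μ = ν :=
  JetForm.ext (funext fun x => congrArg Subtype.val (h x))

theorem pairing_eq_zero_iff {m : ℕ} {x : M} {a b : OmniFiber B F E (m + 1) x} :
    pairing a b = 0 ↔ contract b.2 a.1 + contract a.2 b.1 = 0 := by
  rw [pairing, smul_eq_zero_iff_right (by norm_num)]

theorem mem_graphB {n : ℕ} {μ : JetForm B F E (n + 1)} {x : M} {a : OmniFiber B F E n x} :
    a ∈ graphB μ x ↔ a.2 = contract (μ.at x) a.1 :=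
  LinearMap.mem_graph_iff (contract (μ.at x)) a

theorem graphB_injective {n : ℕ} {μ ν : JetForm B F E (n + 1)} (h : graphB μ = graphB ν) :
    μ = ν := by
  refine JetForm.ext_at fun x => contract_injective fun δ => ?_
  have h1 : ((δ, contract (μ.at x) δ) : OmniFiber B F E n x) ∈ graphB ν x := by
    rw [← h]
    exact mem_graphB.2 rfl
  exact mem_graphB.1 h1

theorem contract_contract_self {k : ℕ} {x : M}
    (μ : jetFiber (B := B) (F := F) (E := E) (k + 2) x) (δ : gaugeFiber B F E x) :
    contract (contract μ δ) δ = 0 :=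
  Subtype.ext (AlternatingMap.curryLeft_same μ.1 δ)

theorem isIsotropic_graphB {m : ℕ} (μ : JetForm B F E (m + 2)) : IsIsotropic (graphB μ) := by
  intro x a ha b hb
  rw [pairing_eq_zero_iff, mem_graphB.1 ha, mem_graphB.1 hb]
  have h := contract_contract_self (μ.at x) (a.1 + b.1)
  simpa only [map_add, contract_add, contract_contract_self, zero_add, add_zero] using h

theorem projectsIsomorphically_graphB {n : ℕ} (μ : JetForm B F E (n + 1)) :
    ProjectsIsomorphically (graphB μ) := by
  intro x
  refine ⟨fun a b hab => ?_, fun δ => ⟨⟨(δ, contract (μ.at x) δ), mem_graphB.2 rfl⟩, rfl⟩⟩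
  refine Subtype.ext (Prod.ext hab ?_)
  rw [mem_graphB.1 a.2, mem_graphB.1 b.2]
  exact congrArg _ hab

theorem OmniSec.isIn_graphB {n : ℕ} {μ : JetForm B F E (n + 1)} {e : OmniSec B F E n} :
    e.IsIn (graphB μ) ↔ e.snd = μ.contractWith e.fst := by
  constructor
  · intro h
    exact JetForm.ext_at fun x => mem_graphB.1 (h x)
  · intro h x
    refine mem_graphB.2 ?_
    change e.snd.at x = _
    rw [h]
    rfl

/-- An isotropic family containing the graph of `B_μ` equals it: the difference of two elements over
the same point of `𝔇E` is a form orthogonal to all of `𝔇E`. -/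
theorem eq_graphB_of_le {m : ℕ} {μ : JetForm B F E (m + 2)} {L : SubFamily B F E (m + 1)}
    (hL : IsIsotropic L) (h : ∀ x, graphB μ x ≤ L x) : L = graphB μ := by
  funext x
  refine le_antisymm (fun a ha => ?_) (h x)
  rw [mem_graphB]
  have h1 : ((a.1, contract (μ.at x) a.1) : OmniFiber B F E (m + 1) x) ∈ L x :=
    h x (mem_graphB.2 rfl)
  have h2 := (L x).sub_mem ha h1
  rw [← sub_eq_zero]
  refine contract_injective fun δ => ?_
  have h3 := pairing_eq_zero_iff.1
    (hL x _ h2 (δ, contract (μ.at x) δ) (h x (mem_graphB.2 rfl)))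
  simp only [Prod.fst_sub, Prod.snd_sub, sub_self, map_zero, zero_add] at h3
  rw [h3]
  rfl

section Graph

variable {V W : Type*} [AddCommGroup V] [Module ℝ V] [AddCommGroup W] [Module ℝ W]

theorem exists_eq_graph {L : Submodule ℝ (V × W)}
    (h : Function.Bijective (fun e : L => e.1.1)) : ∃ T : V →ₗ[ℝ] W, L = T.graph := by
  let e : L ≃ₗ[ℝ] V := LinearEquiv.ofBijective (LinearMap.fst ℝ V W ∘ₗ L.subtype) h
  have he : ∀ a : L, e a = a.1.1 := fun _ => rfl
  refine ⟨LinearMap.snd ℝ V W ∘ₗ L.subtype ∘ₗ e.symm.toLinearMap, ?_⟩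
  ext a
  rw [LinearMap.mem_graph_iff]
  constructor
  · intro ha
    have h1 : e.symm a.1 = ⟨a, ha⟩ := e.symm_apply_eq.2 rfl
    simp [h1]
  · intro ha
    have h1 : (e.symm a.1).1 = a := Prod.ext (e.apply_symm_apply a.1) ha.symm
    rw [← h1]
    exact (e.symm a.1).2

theorem linearIndependent_fst_of_span_eq_graph {r : ℕ} {e : Fin r → V × W} {T : V →ₗ[ℝ] W}
    (he : LinearIndependent ℝ e) (hs : Submodule.span ℝ (Set.range e) = T.graph) :
    LinearIndependent ℝ (fun i => (e i).1) ∧ r = Module.finrank ℝ V := by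
  have hT : ∀ i, (e i).2 = T (e i).1 := fun i => by
    rw [← LinearMap.mem_graph_iff, ← hs]
    exact Submodule.subset_span ⟨i, rfl⟩
  have hli : LinearIndependent ℝ (fun i => (e i).1) := by
    rw [Fintype.linearIndependent_iff] at he ⊢
    intro c hc
    refine he c (Prod.ext ?_ ?_)
    · rw [Prod.fst_sum]
      exact hc
    · rw [Prod.snd_sum]
      simp only [Prod.smul_snd, hT, ← map_smul, ← map_sum, hc]
      exact map_zero T
  refine ⟨hli, ?_⟩
  have hsp : ⊤ ≤ Submodule.span ℝ (Set.range fun i => (e i).1) := by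
    intro v _
    have h1 : (v, T v) ∈ Submodule.span ℝ (Set.range e) := by
      rw [hs, LinearMap.mem_graph_iff]
    have h2 := Submodule.mem_map_of_mem (f := LinearMap.fst ℝ V W) h1
    rwa [Submodule.map_span, ← Set.range_comp] at h2
  rw [Module.finrank_eq_card_basis (Module.Basis.mk hli hsp), Fintype.card_fin]

end Graph

section Frame

variable [FiniteDimensional ℝ B] [T2Space M] [FiniteDimensional ℝ F]
    [ContMDiffVectorBundle ∞ F E 𝓘(ℝ, B)]

theorem anchor_surjective (x : M) : Function.Surjective (anchor (B := B) (F := F) (E := E) x) := by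
  intro v
  have : IsManifold 𝓘(ℝ, B) (((⊤ : ℕ∞) : WithTop ℕ∞) + 1) M := by simpa
  obtain ⟨φ⟩ := nonempty_bundleFrame (B := B) (F := F) (E := E) x
  obtain ⟨τ⟩ := nonempty_bundleFrame (B := B) (F := B) (E := (TangentSpace 𝓘(ℝ, B) : M → Type _)) x
  refine ⟨(φ.lift (∑ i, τ.coeff i x v • τ.sec i)).toFun x, ?_⟩
  rw [φ.anchor_lift, φ.weight_eq_one.self_of_nhds, one_smul, sum_sec_apply]
  exact (τ.sum_coeff x v).trans (by rw [τ.weight_eq_one.self_of_nhds, one_smul])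

/-- The kernel of the anchor consists of the endomorphisms. -/
theorem exists_eq_ofEnd {x : M} {δ : gaugeFiber B F E x} (h : anchor x δ = 0) :
    ∃ Φ : E x →ₗ[ℝ] E x, δ = ofEnd Φ := by
  obtain ⟨φ⟩ := nonempty_bundleFrame (B := B) (F := F) (E := E) x
  refine ⟨∑ i, (φ.coeff i x).smulRight (act δ (φ.sec i)),
    φ.eventually_ext.self_of_nhds _ _ h fun j => ?_⟩
  change _ = (∑ i, (φ.coeff i x).smulRight (act δ (φ.sec i))) (φ.sec j x)
  simp [LinearMap.sum_apply, φ.coeff_sec.self_of_nhds]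

/-- A skew-symmetric bundle map `𝔇E → 𝔍ₘ₊₁E` is, in each fibre, the contraction of an element of
`𝔍ₘ₊₂E`. The value `β` at the identity of `E` vanishes on `gl(E)`, and the value at any other
endomorphism `Φ` is `Φ ∘ β`. -/
theorem exists_contract_eq {m : ℕ} {x : M}
    (T : gaugeFiber B F E x →ₗ[ℝ] jetFiber (B := B) (F := F) (E := E) (m + 1) x)
    (hT : ∀ δ ε, contract (T ε) δ + contract (T δ) ε = 0) :
    ∃ μ : jetFiber (B := B) (F := F) (E := E) (m + 2) x, contract μ = T := by
  have hskew : ∀ δ ε, (T ε).1.curryLeft δ = -(T δ).1.curryLeft ε := fun δ ε =>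
    eq_neg_of_add_eq_zero_left (congrArg Subtype.val (hT δ ε))
  set T' := (jetFiber (m + 1) x).subtype ∘ₗ T with hT'
  have hself : ∀ δ, (T' δ).curryLeft δ = 0 := by
    intro δ
    have h := congrArg Subtype.val (hT δ δ)
    change (T' δ).curryLeft δ + (T' δ).curryLeft δ = 0 at h
    rwa [← two_smul ℝ, smul_eq_zero_iff_right two_ne_zero] at h
  set β := (T (ofEnd LinearMap.id)).1 with hβ
  -- By skew symmetry, `ι_δ (T Φ) = -ι_Φ (T δ)`, which depends on `Φ` only by composition.
  have hΦ : ∀ (Φ : E x →ₗ[ℝ] E x), (T (ofEnd Φ)).1 = Φ.compAlternatingMap β := by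
    intro Φ
    refine AlternatingMap.ext_curryLeft fun δ => ?_
    obtain ⟨l, hl⟩ := (T δ).2
    rw [hskew δ (ofEnd Φ), AlternatingMap.curryLeft_compAlternatingMap, hβ,
      hskew δ (ofEnd LinearMap.id)]
    ext ε
    change -(T δ).1 (Matrix.vecCons _ ε) = Φ (-(T δ).1 (Matrix.vecCons _ ε))
    rw [hl, hl, map_neg]
    rfl
  -- `ι_Φ β` is the composition of `Φ` and `ι_Id β = 0`.
  have hker : ∀ δ, anchor x δ = 0 → β.curryLeft δ = 0 := by
    intro δ hδ
    obtain ⟨Φ, rfl⟩ := exists_eq_ofEnd hδ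
    obtain ⟨l, hl⟩ := (T (ofEnd LinearMap.id)).2
    ext ε
    have h0 := DFunLike.congr_fun (hself (ofEnd LinearMap.id)) ε
    replace h0 : (T (ofEnd LinearMap.id)).1 (Matrix.vecCons _ ε) = 0 := h0
    rw [hl] at h0
    rw [AlternatingMap.curryLeft_apply_apply, hβ, hl]
    exact (congrArg Φ h0).trans (map_zero Φ)
  obtain ⟨l, hl⟩ := AlternatingMap.exists_eq_compLinearMap_of_ker _ (anchor_surjective x) β hker
  refine ⟨⟨AlternatingMap.uncurryLeft T' hself,
    l, fun Φ δ => ?_⟩, ?_⟩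
  · rw [← AlternatingMap.curryLeft_apply_apply, AlternatingMap.curryLeft_uncurryLeft]
    change (T (ofEnd Φ)).1 δ = _
    rw [hΦ, ← hl]
    rfl
  · ext1 δ
    refine Subtype.ext ?_
    rw [coe_contract]
    exact AlternatingMap.curryLeft_uncurryLeft T' hself δ

theorem isSubbundle_graphB {n : ℕ} (μ : JetForm B F E (n + 1)) : IsSubbundle (graphB μ) := by
  intro x₀
  obtain ⟨φ⟩ := nonempty_gaugeFrame (B := B) (F := F) (E := E) x₀
  refine ⟨_, φ.sum_coeff.and φ.coeff_sec, φ.rank,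
    fun i => ⟨φ.sec i, μ.contractWith (φ.sec i)⟩, ?_⟩
  rintro x ⟨hsum, hdual⟩
  set e : Fin φ.rank → OmniFiber B F E n x := fun i =>
    ((φ.sec i).toFun x, contract (μ.at x) ((φ.sec i).toFun x)) with he
  change LinearIndependent ℝ e ∧ Submodule.span ℝ (Set.range e) = _
  constructor
  · rw [Fintype.linearIndependent_iff]
    intro c hc i
    have h1 := congrArg Prod.fst hc
    rw [Prod.fst_sum] at h1
    have h2 := congrArg (φ.coeff i x) h1
    simpa [he, hdual] using h2
  · refine le_antisymm (Submodule.span_le.2 ?_) fun a ha => ?_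
    · rintro _ ⟨i, rfl⟩
      exact mem_graphB.2 rfl
    · have ha' : a = ∑ i, φ.coeff i x a.1 • e i := by
        refine Prod.ext ?_ ?_
        · rw [Prod.fst_sum]
          exact (hsum a.1).symm
        · rw [mem_graphB.1 ha, Prod.snd_sum]
          conv_lhs => rw [← hsum a.1, map_sum]
          exact Finset.sum_congr rfl fun i _ => map_smul _ _ _
      rw [ha']
      exact Submodule.sum_mem _ fun i _ =>
        Submodule.smul_mem _ _ (Submodule.subset_span ⟨i, rfl⟩)

theorem isMaximalIsotropic_graphB {m : ℕ} (μ : JetForm B F E (m + 2)) :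
    IsMaximalIsotropic (graphB μ) :=
  ⟨⟨isSubbundle_graphB μ, isIsotropic_graphB μ⟩, fun _ _ hL h => eq_graphB_of_le hL h⟩

/-- The coefficients of a smooth derivation with respect to a smooth family of derivations which is
a basis at `x₀` are smooth at `x₀`. -/
theorem exists_contMDiffAt_coeff {x₀ : M} {r : ℕ} (d : Fin r → GaugeSec B F E)
    (hd : LinearIndependent ℝ (fun i => (d i).toFun x₀))
    (hr : r = Module.finrank ℝ (gaugeFiber B F E x₀)) (δ : GaugeSec B F E) :
    ∃ a : Fin r → M → ℝ, (∀ i, ContMDiffAt 𝓘(ℝ, B) 𝓘(ℝ, ℝ) ∞ (a i) x₀) ∧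
      ∀ᶠ x in nhds x₀, δ.toFun x = ∑ i, a i x • (d i).toFun x := by
  obtain ⟨φ⟩ := nonempty_gaugeFrame (B := B) (F := F) (E := E) x₀
  have hrank : r = φ.rank := by
    have hli : LinearIndependent ℝ (fun i => (φ.sec i).toFun x₀) := by
      rw [Fintype.linearIndependent_iff]
      intro c hc i
      simpa [φ.coeff_sec.self_of_nhds] using congrArg (φ.coeff i x₀) hc
    have hsp : ⊤ ≤ Submodule.span ℝ (Set.range fun i => (φ.sec i).toFun x₀) := by
      intro ε _
      rw [← φ.sum_coeff.self_of_nhds ε]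
      exact Submodule.sum_mem _ fun i _ =>
        Submodule.smul_mem _ _ (Submodule.subset_span ⟨i, rfl⟩)
    rw [hr, Module.finrank_eq_card_basis (Module.Basis.mk hli hsp), Fintype.card_fin]
  subst hrank
  -- The coefficients are given by Cramer's rule, applied to the matrix of `d` in the frame `φ`.
  let A : M → Matrix (Fin φ.rank) (Fin φ.rank) ℝ := fun x i j => φ.coeff i x ((d j).toFun x)
  have hA : ∀ i j, ContMDiffAt 𝓘(ℝ, B) 𝓘(ℝ, ℝ) ∞ (fun x => A x i j) x₀ := fun i j =>
    (φ.smooth_coeff i (d j)).contMDiffAt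
  have hdet : ∀ {C : M → Matrix (Fin φ.rank) (Fin φ.rank) ℝ},
      (∀ i j, ContMDiffAt 𝓘(ℝ, B) 𝓘(ℝ, ℝ) ∞ (fun x => C x i j) x₀) →
      ContMDiffAt 𝓘(ℝ, B) 𝓘(ℝ, ℝ) ∞ (fun x => (C x).det) x₀ := by
    intro C hC
    simp only [Matrix.det_apply']
    refine ContMDiffAt.sum fun σ _ => ?_
    exact contMDiffAt_const.mul (ContMDiffAt.prod fun i _ => hC _ _)
  have hexp : ∀ x (c : Fin φ.rank → ℝ) i,
      φ.coeff i x (∑ j, c j • (d j).toFun x) = (A x).mulVec c i := by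
    intro x c i
    simp [A, Matrix.mulVec, dotProduct, mul_comm]
  have hA₀ : (A x₀).det ≠ 0 := by
    rw [← isUnit_iff_ne_zero, ← Matrix.isUnit_iff_isUnit_det, ← Matrix.mulVec_injective_iff_isUnit]
    intro c c' hcc
    have h1 : ∑ j, c j • (d j).toFun x₀ = ∑ j, c' j • (d j).toFun x₀ := by
      rw [← φ.sum_coeff.self_of_nhds (∑ j, c j • (d j).toFun x₀),
        ← φ.sum_coeff.self_of_nhds (∑ j, c' j • (d j).toFun x₀)]
      simp only [hexp]
      exact Finset.sum_congr rfl fun i _ => by rw [show (A x₀).mulVec c = _ from hcc]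
    have h2 : ∑ j, (c j - c' j) • (d j).toFun x₀ = 0 := by
      rw [Finset.sum_congr rfl fun j _ => sub_smul (c j) (c' j) ((d j).toFun x₀),
        Finset.sum_sub_distrib, h1, sub_self]
    funext i
    exact sub_eq_zero.1 (Fintype.linearIndependent_iff.1 hd _ h2 i)
  have hadj : ∀ i j, ContMDiffAt 𝓘(ℝ, B) 𝓘(ℝ, ℝ) ∞ (fun x => (A x).adjugate i j) x₀ := by
    intro i j
    simp only [Matrix.adjugate_apply]
    refine hdet fun k l => ?_
    by_cases hk : k = j
    · subst hk
      simp only [Matrix.updateRow_self]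
      exact contMDiffAt_const
    · simp only [Matrix.updateRow_ne hk]
      exact hA k l
  refine ⟨fun i x => (A x).det⁻¹ *
    ∑ j, (A x).adjugate i j * φ.coeff j x (δ.toFun x), fun i => ?_, ?_⟩
  · refine ContMDiffAt.mul ?_ ?_
    · exact ((contDiffAt_inv ℝ hA₀).contMDiffAt).comp x₀ (hdet hA)
    · exact ContMDiffAt.sum fun j _ => (hadj i j).mul (φ.smooth_coeff j δ).contMDiffAt
  · filter_upwards [φ.sum_coeff, (hdet hA).continuousAt.eventually_ne hA₀] with x hx hne
    rw [← hx (∑ i, _ • (d i).toFun x)]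
    conv_lhs => rw [← hx (δ.toFun x)]
    refine Finset.sum_congr rfl fun i _ => ?_
    rw [hexp]
    congr 1
    set c : Fin φ.rank → ℝ := fun j => φ.coeff j x (δ.toFun x) with hc
    have h1 : (fun i => (A x).det⁻¹ * ∑ j, (A x).adjugate i j * c j) =
        (A x).det⁻¹ • (A x).adjugate.mulVec c := rfl
    rw [h1, Matrix.mulVec_smul, Matrix.mulVec_mulVec, Matrix.mul_adjugate, Matrix.smul_mulVec,
      Matrix.one_mulVec, smul_smul, inv_mul_cancel₀ hne, one_smul]

/-- A bundle map `𝔇E → 𝔍ₙE` whose graph is a smooth subbundle is smooth. -/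
theorem contMDiff_of_isSubbundle_graph {n : ℕ}
    (T : ∀ x, gaugeFiber B F E x →ₗ[ℝ] jetFiber (B := B) (F := F) (E := E) n x)
    (hT : IsSubbundle (fun x => (T x).graph)) (δ : GaugeSec B F E) (ε : Fin n → GaugeSec B F E) :
    ContMDiff 𝓘(ℝ, B) (𝓘(ℝ, B).prod 𝓘(ℝ, F)) ∞
      (fun x => TotalSpace.mk' F x ((T x (δ.toFun x)).1 (fun i => (ε i).toFun x))) := by
  intro x₀
  obtain ⟨U, hU, r, s, hs⟩ := hT x₀
  have hs₀ := hs x₀ (mem_of_mem_nhds hU)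
  have hsT : ∀ x ∈ U, ∀ i, T x ((s i).fst.toFun x) = (s i).snd.at x := fun x hx i => by
    have h : (s i).at x ∈ (T x).graph := by
      rw [← show _ = (T x).graph from (hs x hx).2]
      exact Submodule.subset_span ⟨i, rfl⟩
    exact ((LinearMap.mem_graph_iff (T x) _).1 h).symm
  obtain ⟨hli, hr⟩ := linearIndependent_fst_of_span_eq_graph hs₀.1 hs₀.2
  obtain ⟨a, ha, hδ⟩ := exists_contMDiffAt_coeff (fun i => (s i).fst) hli hr δ
  have hsm : ContMDiffAt 𝓘(ℝ, B) (𝓘(ℝ, B).prod 𝓘(ℝ, F)) ∞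
      (fun x => TotalSpace.mk' F x (∑ i, a i x • (s i).snd.eval ε x)) x₀ :=
    ContMDiffAt.sum_section (s := Finset.univ) fun i _ =>
      (ha i).smul_section ((s i).snd.eval ε).contMDiff.contMDiffAt
  refine hsm.congr_of_eventuallyEq ?_
  filter_upwards [hδ, hU] with x hx hxU
  have h1 : T x (δ.toFun x) = ∑ i, a i x • (s i).snd.at x := by
    rw [hx, map_sum]
    exact Finset.sum_congr rfl fun i _ => by rw [map_smul, hsT x hxU]
  let ev : jetFiber (B := B) (F := F) (E := E) n x →ₗ[ℝ] E x :=
    { toFun := fun μ => μ.1 (fun i => (ε i).toFun x)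
      map_add' := fun _ _ => rfl
      map_smul' := fun _ _ => rfl }
  have h2 : ev (T x (δ.toFun x)) = ∑ i, a i x • (s i).snd.eval ε x := by
    rw [h1, map_sum]
    exact Finset.sum_congr rfl fun i _ => map_smul ev _ _
  exact congrArg _ h2

/-- An isotropic subbundle which is the graph of a bundle map `𝔇E → 𝔍ₘ₊₁E` is the graph of a
form. -/
theorem exists_graph_eq_graphB {m : ℕ}
    (T : ∀ x, gaugeFiber B F E x →ₗ[ℝ] jetFiber (B := B) (F := F) (E := E) (m + 1) x)
    (hsub : IsSubbundle (fun x => (T x).graph)) (hiso : IsIsotropic (fun x => (T x).graph)) :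
    ∃ μ : JetForm B F E (m + 2), ∀ x, (T x).graph = graphB μ x := by
  have hmem : ∀ x δ, ((δ, T x δ) : OmniFiber B F E (m + 1) x) ∈ (T x).graph := fun x δ =>
    (LinearMap.mem_graph_iff (T x) _).2 rfl
  have hskew : ∀ x δ ε, contract (T x ε) δ + contract (T x δ) ε = 0 := fun x δ ε =>
    (pairing_eq_zero_iff (a := (δ, T x δ)) (b := (ε, T x ε))).1
      (hiso x _ (hmem x δ) _ (hmem x ε))
  choose μ hμ using fun x => exists_contract_eq (T x) (hskew x)
  refine ⟨⟨⟨fun x => (μ x).1, fun δ => ?_⟩, fun x => (μ x).2⟩, fun x => ?_⟩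
  · refine (contMDiff_of_isSubbundle_graph T hsub (δ 0) (Matrix.vecTail δ)).congr fun x => ?_
    rw [← hμ, coe_contract, AlternatingMap.apply_eq_curryLeft (μ x).1 (fun i => (δ i).toFun x)]
    rfl
  · exact congrArg LinearMap.graph (hμ x).symm

/-- An isotropic subbundle which projects isomorphically onto `𝔇E` is the graph of a form. -/
theorem exists_eq_graphB {m : ℕ} {L : SubFamily B F E (m + 1)} (hsub : IsSubbundle L)
    (hiso : IsIsotropic L) (hproj : ProjectsIsomorphically L) :
    ∃ μ : JetForm B F E (m + 2), L = graphB μ := by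
  have hT : ∀ x, ∃ T : gaugeFiber B F E x →ₗ[ℝ] jetFiber (B := B) (F := F) (E := E) (m + 1) x,
      L x = T.graph := fun x => exists_eq_graph (hproj x)
  choose T hT using hT
  have hL : L = fun x => (T x).graph := funext hT
  rw [hL] at hsub hiso
  obtain ⟨μ, hμ⟩ := exists_graph_eq_graphB T hsub hiso
  exact ⟨μ, funext fun x => (hT x).trans (hμ x)⟩

end Frame

/-! ### Involutivity, closed forms and exact forms -/

section Involutivity

variable [FiniteDimensional ℝ B]

theorem JetForm.closed_iff {k : ℕ} {μ : JetForm B F E k} :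
    μ.Closed ↔ LieCochain.differential k μ.toCochain = 0 := by
  constructor
  · intro h
    ext1 δ
    rw [← deRham_eq_differential, h]
    rfl
  · intro h δ
    rw [deRham_eq_differential, h]
    rfl

/-- The Dorfman bracket of `δ + ι_δ μ` and `ε + ι_ε μ` differs from `[δ, ε] + ι_[δ, ε] μ` by
`ι_ε ι_δ dμ`. -/
theorem dorfman_contractWith {k : ℕ} (μ : JetForm B F E (k + 2)) (δ ε : GaugeSec B F E)
    (η : Fin (k + 1) → GaugeSec B F E) :
    lieDeriv δ (μ.contractWith ε).toGaugeForm η -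
        deRham (μ.contractWith δ).toGaugeForm (Matrix.vecCons ε η) =
      (μ.contractWith ⁅δ, ε⁆).eval η +
        deRham μ.toGaugeForm (Matrix.vecCons δ (Matrix.vecCons ε η)) := by
  have h := DFunLike.congr_fun (congrArg (fun α => AlternatingMap.curryLeft α ε)
    (LieCochain.curryLeft_differential δ μ.toCochain)) η
  simp only [AlternatingMap.curryLeft_sub, LieCochain.curryLeft_lieDeriv,
    AlternatingMap.sub_apply] at h
  rw [lieDeriv_eq_lieDeriv, deRham_eq_differential, deRham_eq_differential,
    ← GaugeForm.toCochain_apply, JetForm.contractWith_toCochain, JetForm.contractWith_toCochain,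
    JetForm.contractWith_toCochain, ← AlternatingMap.curryLeft_apply_apply,
    ← AlternatingMap.curryLeft_apply_apply _ δ, ← AlternatingMap.curryLeft_apply_apply _ ε η, h]
  abel

theorem isInvolutive_graphB_iff {k : ℕ} (μ : JetForm B F E (k + 2)) :
    IsInvolutive (graphB μ) ↔ μ.Closed := by
  constructor
  · intro h ζ
    obtain ⟨δ, ζ, rfl⟩ : ∃ δ ζ', ζ = Matrix.vecCons δ ζ' := ⟨_, _, (Matrix.cons_head_tail ζ).symm⟩
    obtain ⟨ε, η, rfl⟩ : ∃ ε η, ζ = Matrix.vecCons ε η := ⟨_, _, (Matrix.cons_head_tail ζ).symm⟩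
    obtain ⟨e, ⟨he1, he2⟩, he3⟩ := h ⟨δ, μ.contractWith δ⟩ ⟨ε, μ.contractWith ε⟩
      (OmniSec.isIn_graphB.2 rfl) (OmniSec.isIn_graphB.2 rfl)
    have h1 := he2 η
    rw [dorfman_contractWith, OmniSec.isIn_graphB.1 he3, he1] at h1
    exact (left_eq_add.1 h1)
  · intro h e₁ e₂ h₁ h₂
    refine ⟨⟨⁅e₁.fst, e₂.fst⁆, μ.contractWith ⁅e₁.fst, e₂.fst⁆⟩, ⟨rfl, fun η => ?_⟩,
      OmniSec.isIn_graphB.2 rfl⟩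
    rw [OmniSec.isIn_graphB.1 h₁, OmniSec.isIn_graphB.1 h₂, dorfman_contractWith, h, add_zero]

/-- The contraction with the identity of `E` is a contracting homotopy of the de Rham complex. -/
theorem eq_contract_idSec {k : ℕ} (α : GaugeSec B F E [⋀^Fin (k + 1)]→ₗ[ℝ] Sec B F E) :
    α = (LieCochain.differential (k + 1) α).curryLeft (idSec B F E) +
      LieCochain.differential k (α.curryLeft (idSec B F E)) :=
  LieCochain.eq_of_central idSec_lie idSec_op α

theorem JetForm.Closed.toCochain_eq {k : ℕ} {μ : JetForm B F E (k + 1)} (h : μ.Closed) :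
    μ.toCochain = LieCochain.differential k (μ.contractWith (idSec B F E)).toCochain := by
  have h1 := eq_contract_idSec μ.toCochain
  rwa [JetForm.closed_iff.1 h, AlternatingMap.curryLeft_zero, LinearMap.zero_apply, zero_add,
    ← JetForm.contractWith_toCochain] at h1

theorem GaugeForm.toCochain_eq_differential {k : ℕ} {μ : GaugeForm B F E (k + 1)}
    {η : GaugeForm B F E k} (h : ∀ δ, μ.eval δ = deRham η δ) :
    μ.toCochain = LieCochain.differential k η.toCochain := by
  ext1 δ
  rw [← deRham_eq_differential, ← h]
  rfl

theorem JetForm.closed_of_eval_eq {k : ℕ} {μ : JetForm B F E (k + 1)} {η : GaugeForm B F E k}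
    (h : ∀ δ, μ.eval δ = deRham η δ) : μ.Closed := by
  rw [JetForm.closed_iff, GaugeForm.toCochain_eq_differential h,
    LieCochain.differential_differential]

theorem JetForm.closed_iff_exact {k : ℕ} (μ : JetForm B F E (k + 1)) : μ.Closed ↔ μ.Exact := by
  constructor
  · intro h
    refine ⟨μ.contractWith (idSec B F E), fun δ => ?_⟩
    rw [deRham_eq_differential, ← h.toCochain_eq]
    rfl
  · rintro ⟨η, hη⟩
    exact JetForm.closed_of_eval_eq hη

end Involutivity

/-! ### Forms on the base manifold -/

theorem ValuedForm.pullback_eval_eq_zero {k : ℕ} (ν : ValuedForm B F E k)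
    {δ : Fin k → GaugeSec B F E} {i : Fin k} (h : (δ i).symbol = 0) : ν.pullback.eval δ = 0 := by
  ext x
  exact (ν.toFun x).map_coord_zero i (DFunLike.congr_fun h x)

theorem ValuedForm.curryLeft_pullback {k : ℕ} (ν : ValuedForm B F E (k + 1))
    {δ : GaugeSec B F E} (h : δ.symbol = 0) : ν.pullback.toCochain.curryLeft δ = 0 := by
  ext1 ε
  exact ν.pullback_eval_eq_zero (i := 0) h

variable [FiniteDimensional ℝ B]

/-- A form `𝕛^*ν` is recovered from its differential by contraction with the identity of `E`. -/
theorem ValuedForm.curryLeft_differential_pullback {k : ℕ} (ν : ValuedForm B F E (k + 1)) :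
    (LieCochain.differential (k + 1) ν.pullback.toCochain).curryLeft (idSec B F E) =
      ν.pullback.toCochain := by
  conv_rhs => rw [eq_contract_idSec ν.pullback.toCochain, ν.curryLeft_pullback rfl, map_zero,
    add_zero]

section Extension

variable [T2Space M] [FiniteDimensional ℝ F] [ContMDiffVectorBundle ∞ F E 𝓘(ℝ, B)]

theorem ValuedForm.pullback_injective {k : ℕ} {ν ν' : ValuedForm B F E k}
    (h : ν.pullback = ν'.pullback) : ν = ν' := by
  ext x v
  choose δ hδ using fun i => anchor_surjective (B := B) (F := F) (E := E) x (v i)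
  have := DFunLike.congr_fun (congrFun (congrArg GaugeForm.toFun h) x) δ
  change ν.toFun x (fun i => anchor x (δ i)) = ν'.toFun x (fun i => anchor x (δ i)) at this
  simpa only [hδ] using this

/-- `d 𝕛^*ν` is a vector bundle form: for `Φ ∈ gl(E)`, Cartan's formula gives
`ι_Φ d 𝕛^*ν = L_Φ 𝕛^*ν = Φ ∘ 𝕛^*ν`. -/
theorem ValuedForm.exists_jetForm {k : ℕ} (ν : ValuedForm B F E (k + 1)) :
    ∃ μ : JetForm B F E (k + 2), ∀ δ, μ.eval δ = deRham ν.pullback δ := by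
  obtain ⟨μ, hμ⟩ := ν.pullback.isTensorial.differential.exists_gaugeForm
  refine ⟨⟨μ, fun x => ⟨ν.toFun x, fun Φ δ => ?_⟩⟩, fun δ => ?_⟩
  · obtain ⟨φ⟩ := nonempty_bundleFrame (B := B) (F := F) (E := E) x
    obtain ⟨Ψ, hΨ, hΨx⟩ := φ.exists_gaugeSec_ofEnd Φ
    obtain ⟨D, hD⟩ := exists_gaugeSec_eq x δ
    have h1 : μ.eval (Matrix.vecCons Ψ D) = Ψ.op (ν.pullback.eval D) := by
      rw [hμ, ← AlternatingMap.curryLeft_apply_apply, LieCochain.curryLeft_differential,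
        ν.curryLeft_pullback hΨ, map_zero, sub_zero, LieCochain.lieDeriv_apply,
        Finset.sum_eq_zero, sub_zero]
      · rfl
      · intro i _
        refine ν.pullback_eval_eq_zero (i := i) ?_
        rw [Function.update_self, symbol_lie_eq_zero hΨ]
    have h2 := DFunLike.congr_fun h1 x
    rw [GaugeForm.eval_vecCons, hΨx] at h2
    simp only [hD] at h2
    rw [h2]
    change act (Ψ.toFun x) (ν.pullback.eval D) = _
    rw [hΨx]
    change Φ (ν.toFun x (fun i => anchor x ((D i).toFun x))) = _
    simp only [hD]
  · rw [deRham_eq_differential]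
    exact hμ δ

/-- The contraction of a vector bundle form with the identity of `E` is the pullback of a form on
the base. Its smoothness is checked on vector fields, which lift to derivations near each point. -/
theorem JetForm.exists_pullback_eq {k : ℕ} (μ : JetForm B F E (k + 1)) :
    ∃ ν : ValuedForm B F E k, ν.pullback = (μ.contractWith (idSec B F E)).toGaugeForm := by
  choose l hl using μ.mem
  have hlid : ∀ x (δ : Fin k → gaugeFiber B F E x),
      μ.toFun x (Matrix.vecCons (ofEnd LinearMap.id) δ) = l x (fun i => anchor x (δ i)) :=
    fun x δ => hl x LinearMap.id δ
  refine ⟨⟨l, fun X => ?_⟩, ?_⟩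
  · intro x₀
    obtain ⟨φ⟩ := nonempty_bundleFrame (B := B) (F := F) (E := E) x₀
    have hs := (μ.eval (Matrix.vecCons (idSec B F E) fun i => φ.lift (X i))).contMDiff x₀
    refine hs.congr_of_eventuallyEq ?_
    filter_upwards [φ.weight_eq_one] with x hx
    rw [GaugeForm.eval_vecCons]
    refine congrArg _ ((hlid x _).trans ?_).symm
    simp only [φ.anchor_lift, hx, one_smul]
  · refine GaugeForm.ext (funext fun x => ?_)
    ext δ
    exact (hlid x δ).symm

theorem isHigherDiracJacobi_graphB_iff {m : ℕ} (μ : JetForm B F E (m + 2)) :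
    IsHigherDiracJacobi (graphB μ) ↔ μ.Closed :=
  (and_iff_right (isMaximalIsotropic_graphB μ)).trans (isInvolutive_graphB_iff μ)

theorem JetForm.ext_toCochain {k : ℕ} {μ ν : JetForm B F E k}
    (h : μ.toCochain = ν.toCochain) : μ = ν := by
  have h1 : μ.toGaugeForm = ν.toGaugeForm := GaugeForm.ext_eval fun δ => DFunLike.congr_fun h δ
  exact JetForm.ext (congrArg GaugeForm.toFun h1)

end Extension

end OmniLie

end

/-- `n = m + 1` is an arbitrary positive integer. -/
theorem mainTheorem2
    {B : Type*} [NormedAddCommGroup B] [NormedSpace ℝ B] [FiniteDimensional ℝ B]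
    {M : Type*} [TopologicalSpace M] [T2Space M] [SigmaCompactSpace M]
    [ChartedSpace B M] [IsManifold 𝓘(ℝ, B) ∞ M]
    {F : Type*} [NormedAddCommGroup F] [NormedSpace ℝ F] [FiniteDimensional ℝ F]
    {E : M → Type*} [TopologicalSpace (TotalSpace F E)]
    [∀ x, AddCommGroup (E x)] [∀ x, Module ℝ (E x)] [∀ x, TopologicalSpace (E x)]
    [FiberBundle F E] [VectorBundle ℝ F E] [ContMDiffVectorBundle ∞ F E 𝓘(ℝ, B)]
    (m : ℕ) :
    -- the graph of `B_μ` is a maximal isotropic subbundle (projecting isomorphically onto `𝔇E`)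
    (∀ μ : JetForm B F E (m + 2), IsMaximalIsotropic (graphB μ) ∧
      ProjectsIsomorphically (graphB μ)) ∧
    -- every isotropic subbundle projecting isomorphically onto `𝔇E` is such a graph, for unique `μ`
    (∀ L : SubFamily B F E (m + 1), IsSubbundle L → IsIsotropic L → ProjectsIsomorphically L →
      ∃! μ : JetForm B F E (m + 2), L = graphB μ) ∧
    -- the graph is involutive, i.e. a higher Dirac–Jacobi structure, iff `μ` is closed, iff exact
    (∀ μ : JetForm B F E (m + 2),
      (IsInvolutive (graphB μ) ↔ μ.Closed) ∧
      (IsHigherDiracJacobi (graphB μ) ↔ μ.Closed) ∧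
      (μ.Closed ↔ μ.Exact)) ∧
    -- `ν ↦ graph B_{d 𝕛^*ν}` is a bijection from `Ωⁿ(M, E)` to these structures
    (∃ Ψ : ValuedForm B F E (m + 1) →
        {L : SubFamily B F E (m + 1) // IsHigherDiracJacobi L ∧ ProjectsIsomorphically L},
      Function.Bijective Ψ ∧
      ∀ ν : ValuedForm B F E (m + 1), ∃ μ : JetForm B F E (m + 2),
        (∀ δ, μ.eval δ = deRham ν.pullback δ) ∧ (Ψ ν).1 = graphB μ) := by
  refine ⟨fun μ => ⟨isMaximalIsotropic_graphB μ, projectsIsomorphically_graphB μ⟩,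
    fun L hsub hiso hproj => ?_,
    fun μ => ⟨isInvolutive_graphB_iff μ, isHigherDiracJacobi_graphB_iff μ, μ.closed_iff_exact⟩, ?_⟩
  · obtain ⟨μ, hμ⟩ := exists_eq_graphB hsub hiso hproj
    exact ⟨μ, hμ, fun μ' hμ' => graphB_injective (hμ'.symm.trans hμ)⟩
  · choose f hf using fun ν : ValuedForm B F E (m + 1) => ν.exists_jetForm
    have hcochain : ∀ ν, (f ν).toCochain =
        LieCochain.differential (m + 1) ν.pullback.toCochain := fun ν =>
      GaugeForm.toCochain_eq_differential (hf ν)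
    refine ⟨fun ν => ⟨graphB (f ν), (isHigherDiracJacobi_graphB_iff _).2
      (JetForm.closed_of_eval_eq (hf ν)), projectsIsomorphically_graphB _⟩, ⟨?_, ?_⟩,
      fun ν => ⟨f ν, hf ν, rfl⟩⟩
    · intro ν ν' h
      have h1 : f ν = f ν' := graphB_injective (congrArg Subtype.val h)
      refine ValuedForm.pullback_injective (GaugeForm.ext_eval fun δ => ?_)
      rw [← GaugeForm.toCochain_apply, ← GaugeForm.toCochain_apply,
        ← ν.curryLeft_differential_pullback, ← ν'.curryLeft_differential_pullback, ← hcochain,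
        ← hcochain, h1]
    · rintro ⟨L, hL, hproj⟩
      obtain ⟨μ, rfl⟩ := exists_eq_graphB hL.1.1.1 hL.1.1.2 hproj
      have hclosed := (isHigherDiracJacobi_graphB_iff μ).1 hL
      -- The preimage is the form `ν` on the base with `𝕛^*ν = ι_Id μ`.
      obtain ⟨ν, hν⟩ := μ.exists_pullback_eq
      refine ⟨ν, Subtype.ext (congrArg graphB (JetForm.ext_toCochain ?_))⟩
      rw [hcochain, hν, hclosed.toCochain_eq]
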